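/- Let $\mathcal C$ be a small category. Its Brauer envelope $\mathcal B(\mathcal C)$ is the following category. Objects are finite sequences $(X_1^{\varepsilon_1},\dots,X_n^{\varepsilon_n})$ of objects $X_i$ of $\mathcal C$ with signs $\varepsilon_i\in\{+,-\}$; the tensor product is concatenation and the unit $\mathbf 1$ is the empty sequence. Morphisms are generated, under composition and tensor product, by $$\beta_+:X^+\to Y^+,\qquad \beta_-:Y^-\to X^-,\qquad \mathrm{cap}_\beta: X^+\otimes Y^-\to\mathbf 1,\qquad \mathrm{cup}_\beta:\mathbf 1\to X^-\otimes Y^+$$ for every morphism $\beta:X\to Y$ of $\mathcal C$, together with the crossings (transpositions) $A\otimes B\to B\otimes A$, modulo: the axioms of a strict symmetric monoidal category; functoriality, $(\mathrm{id}_X)_\pm=\mathrm{id}$, $(\gamma\beta)_+=\gamma_+\beta_+$, $(\gamma\beta)_-=\beta_-\gamma_-$; absorption, $\mathrm{cap}_\gamma(\beta_+\otimes\delta_-)=\mathrm{cap}_{\delta\gamma\beta}$ and $(\beta_-\otimes\delta_+)\,\mathrm{cup}_\gamma=\mathrm{cup}_{\delta\gamma\beta}$ for $X\xrightarrow{\beta}Y\xrightarrow{\gamma}Z\xrightarrow{\delta}W$;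 and the two zigzag (rigidity) relations between $\mathrm{cap}_{\mathrm{id}_X}$ and $\mathrm{cup}_{\mathrm{id}_X}$. Let $\iota:\mathcal C\to\mathcal B(\mathcal C)$ be the functor $X\mapsto X^+$, $\beta\mapsto\beta_+$. **Proposition.** 1. $\mathcal B(\mathcal C)$ is a strict rigid symmetric monoidal category. The left and the right dual of a sequence can both be taken to be the reversed sequence with all signs reversed, and $X^-$ is dual to $X^+$ by means of $\mathrm{cap}_{\mathrm{id}_X}$ and $\mathrm{cup}_{\mathrm{id}_X}$. 2. $\mathcal C$ is a subcategory of $\mathcal B(\mathcal C)$: the functor $\iota$ is injective on objects and faithful. 3. $\iota$ is universal among functors from $\mathcal C$ to strict rigid symmetric monoidal categories. Namely, let $\mathcal D$ be a strict symmetric monoidal category with a chosen dual $(X^*,\ \mathrm{ev}_X:X\otimes X^*\to\mathbf 1,\ \mathrm{coev}_X:\mathbf 1\to X^*\otimes X)$ of every object $X$, and let $F:\mathcal C\to\mathcal D$ be a functor. Then there is exactly one strict symmetric monoidal functor $G:\mathcal B(\mathcal C)\to\mathcal D$ such that $G\circ\iota=F$ and such that $G$ respects the chosen duals, that is, for every object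 $X$ of $\mathcal C$, $G(X^-)=F(X)^*$, $G(\mathrm{cap}_{\mathrm{id}_X})=\mathrm{ev}_{F(X)}$ and $G(\mathrm{cup}_{\mathrm{id}_X})=\mathrm{coev}_{F(X)}$. Moreover, irrespective of any choice of duals, if $G,H:\mathcal B(\mathcal C)\to\mathcal D$ are strict symmetric monoidal functors to a strict symmetric monoidal category $\mathcal D$, then every natural isomorphism $G\circ\iota\cong H\circ\iota$ extends uniquely to a monoidal natural isomorphism $G\cong H$. -/

import Mathlib

open CategoryTheory MonoidalCategory

universe u v u' v'

/-- The two orientations of a point. -/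
inductive BrauerSign : Type
  | plus
  | minus

/-- The opposite orientation. -/
def BrauerSign.flip : BrauerSign → BrauerSign
  | plus => minus
  | minus => plus

/-- Objects of the Brauer envelope of `C`: finite sequences of pairs (object of `C`, sign). -/
def Brauer (C : Type u) : Type u := List (C × BrauerSign)

namespace Brauer

/-- The empty sequence. -/
def unit (C : Type u) : Brauer C := ([] : List (C × BrauerSign))

/-- Concatenation of sequences. -/
def tensor {C : Type u} (A B : Brauer C) : Brauer C := (List.append A B : List (C × BrauerSign))

/-- The one-term sequence `X⁺`. -/
def pos {C : Type u} (X : C) : Brauer C := [(X, BrauerSign.plus)]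

/-- The one-term sequence `X⁻`. -/
def neg {C : Type u} (X : C) : Brauer C := [(X, BrauerSign.minus)]

/-- The dual sequence: reverse the order and all the signs. -/
def dual {C : Type u} (A : Brauer C) : Brauer C :=
  (List.map (fun a => (a.1, a.2.flip)) (List.reverse A) : List (C × BrauerSign))

theorem tensor_assoc {C : Type u} (A B D : Brauer C) :
    (A.tensor B).tensor D = A.tensor (B.tensor D) :=
  List.append_assoc A B D

theorem tensor_unit {C : Type u} (A : Brauer C) : A.tensor (unit C) = A :=
  List.append_nil A

theorem unit_tensor {C : Type u} (A : Brauer C) : (unit C).tensor A = A :=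
  List.nil_append A

/-- Diagrams: formal composites and formal tensor products (side by side placement) of
* the upward intervals `β₊ : X⁺ ⟶ Y⁺` and the downward intervals `β₋ : Y⁻ ⟶ X⁻`,
* the caps `X⁺ ⊗ Y⁻ ⟶ ∅` and the cups `∅ ⟶ X⁻ ⊗ Y⁺`, for `β : X ⟶ Y` in `C`,
* the crossings of two groups of strands (by the relations below these are composites of the
  transpositions of two adjacent strands). -/
inductive Diagram {C : Type u} [Category.{v} C] : Brauer C → Brauer C → Type (max u v)
  | id (A : Brauer C) : Diagram A A
  | comp {A B D : Brauer C} (f : Diagram A B) (g : Diagram B D) : Diagram A D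
  | tens {A A' B B' : Brauer C} (f : Diagram A A') (g : Diagram B B') :
      Diagram (A.tensor B) (A'.tensor B')
  | cross (A B : Brauer C) : Diagram (A.tensor B) (B.tensor A)
  | up {X Y : C} (β : X ⟶ Y) : Diagram (pos X) (pos Y)
  | down {X Y : C} (β : X ⟶ Y) : Diagram (neg Y) (neg X)
  | cap {X Y : C} (β : X ⟶ Y) : Diagram ((pos X).tensor (neg Y)) (unit C)
  | cup {X Y : C} (β : X ⟶ Y) : Diagram (unit C) ((neg X).tensor (pos Y))

/-- The identity diagram, with its target rewritten along an equality of sequences. -/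
def Diagram.ofEq {C : Type u} [Category.{v} C] {A B : Brauer C} (h : A = B) : Diagram A B :=
  h ▸ Diagram.id A

open Diagram in
/-- Equality of diagrams in the Brauer envelope: the congruence generated by the axioms of a
strict symmetric monoidal category, functoriality of `β ↦ β₊` and `β ↦ β₋`, absorption of
intervals into caps and cups, and the two rigidity (zigzag) relations. -/
inductive Rel {C : Type u} [Category.{v} C] :
    ∀ {A B : Brauer C}, Diagram A B → Diagram A B → Prop
  -- congruence
  | refl {A B : Brauer C} (f : Diagram A B) : Rel f f
  | symm {A B : Brauer C} {f g : Diagram A B} : Rel f g → Rel g f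
  | trans {A B : Brauer C} {f g h : Diagram A B} : Rel f g → Rel g h → Rel f h
  | comp_congr {A B D : Brauer C} {f f' : Diagram A B} {g g' : Diagram B D} :
      Rel f f' → Rel g g' → Rel (comp f g) (comp f' g')
  | tens_congr {A A' B B' : Brauer C} {f f' : Diagram A A'} {g g' : Diagram B B'} :
      Rel f f' → Rel g g' → Rel (tens f g) (tens f' g')
  -- category
  | id_comp {A B : Brauer C} (f : Diagram A B) : Rel (comp (id A) f) f
  | comp_id {A B : Brauer C} (f : Diagram A B) : Rel (comp f (id B)) f
  | assoc {A B D E : Brauer C} (f : Diagram A B) (g : Diagram B D) (h : Diagram D E) :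
      Rel (comp (comp f g) h) (comp f (comp g h))
  -- strict monoidal category
  | tens_id (A B : Brauer C) : Rel (tens (id A) (id B)) (id (A.tensor B))
  | tens_comp {A A' A'' B B' B'' : Brauer C} (f : Diagram A A') (f' : Diagram A' A'')
      (g : Diagram B B') (g' : Diagram B' B'') :
      Rel (comp (tens f g) (tens f' g')) (tens (comp f f') (comp g g'))
  | tens_assoc {A A' B B' D D' : Brauer C} (f : Diagram A A') (g : Diagram B B')
      (h : Diagram D D') :
      Rel (comp (tens (tens f g) h) (ofEq (tensor_assoc A' B' D')))
        (comp (ofEq (tensor_assoc A B D)) (tens f (tens g h)))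
  | unit_tens {A B : Brauer C} (f : Diagram A B) :
      Rel (comp (tens (id (unit C)) f) (ofEq (unit_tensor B))) (comp (ofEq (unit_tensor A)) f)
  | tens_unit {A B : Brauer C} (f : Diagram A B) :
      Rel (comp (tens f (id (unit C))) (ofEq (tensor_unit B))) (comp (ofEq (tensor_unit A)) f)
  -- symmetry
  | cross_natural {A A' B B' : Brauer C} (f : Diagram A A') (g : Diagram B B') :
      Rel (comp (tens f g) (cross A' B')) (comp (cross A B) (tens g f))
  | cross_cross (A B : Brauer C) : Rel (comp (cross A B) (cross B A)) (id (A.tensor B))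
  | hexagon (A B D : Brauer C) :
      Rel
        (comp (ofEq (tensor_assoc A B D))
          (comp (cross A (B.tensor D)) (ofEq (tensor_assoc B D A))))
        (comp (tens (cross A B) (id D))
          (comp (ofEq (tensor_assoc B A D)) (tens (id B) (cross A D))))
  -- intervals compose as in `C`
  | up_id (X : C) : Rel (up (𝟙 X)) (id (pos X))
  | up_comp {X Y Z : C} (β : X ⟶ Y) (γ : Y ⟶ Z) : Rel (comp (up β) (up γ)) (up (β ≫ γ))
  | down_id (X : C) : Rel (down (𝟙 X)) (id (neg X))
  | down_comp {X Y Z : C} (β : X ⟶ Y) (γ : Y ⟶ Z) :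
      Rel (comp (down γ) (down β)) (down (β ≫ γ))
  -- intervals next to a cap or a cup are absorbed
  | cap_absorb {X Y Z W : C} (β : X ⟶ Y) (γ : Y ⟶ Z) (δ : Z ⟶ W) :
      Rel (comp (tens (up β) (down δ)) (cap γ)) (cap (β ≫ γ ≫ δ))
  | cup_absorb {X Y Z W : C} (β : X ⟶ Y) (γ : Y ⟶ Z) (δ : Z ⟶ W) :
      Rel (comp (cup γ) (tens (down β) (up δ))) (cup (β ≫ γ ≫ δ))
  -- rigidity
  | zigzag_pos (X : C) :
      Rel
        (comp (ofEq (tensor_unit (pos X)).symm)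
          (comp (tens (id (pos X)) (cup (𝟙 X)))
            (comp (ofEq (tensor_assoc (pos X) (neg X) (pos X)).symm)
              (comp (tens (cap (𝟙 X)) (id (pos X))) (ofEq (unit_tensor (pos X)))))))
        (id (pos X))
  | zigzag_neg (X : C) :
      Rel
        (comp (ofEq (unit_tensor (neg X)).symm)
          (comp (tens (cup (𝟙 X)) (id (neg X)))
            (comp (ofEq (tensor_assoc (neg X) (pos X) (neg X)))
              (comp (tens (id (neg X)) (cap (𝟙 X))) (ofEq (tensor_unit (neg X)))))))
        (id (neg X))

/-- Diagrams up to equality in the Brauer envelope. -/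
instance diagramSetoid {C : Type u} [Category.{v} C] (A B : Brauer C) : Setoid (Diagram A B) :=
  ⟨Rel, ⟨Rel.refl, Rel.symm, Rel.trans⟩⟩

/-- The Brauer envelope as a category. -/
instance category {C : Type u} [Category.{v} C] : Category.{max u v} (Brauer C) where
  Hom A B := Quotient (diagramSetoid A B)
  id A := ⟦Diagram.id A⟧
  comp := Quotient.map₂ Diagram.comp (fun _ _ hf _ _ hg => Rel.comp_congr hf hg)
  id_comp := by
    rintro A B ⟨f⟩
    exact Quotient.sound (Rel.id_comp f)
  comp_id := by
    rintro A B ⟨f⟩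
    exact Quotient.sound (Rel.comp_id f)
  assoc := by
    rintro A B D E ⟨f⟩ ⟨g⟩ ⟨h⟩
    exact Quotient.sound (Rel.assoc f g h)

/-- The morphism of the Brauer envelope represented by a diagram. -/
def mk {C : Type u} [Category.{v} C] {A B : Brauer C} (f : Diagram A B) : A ⟶ B :=
  (Quotient.mk (diagramSetoid A B) f : Quotient (diagramSetoid A B))

theorem sound {C : Type u} [Category.{v} C] {A B : Brauer C} {f g : Diagram A B} (h : Rel f g) :
    mk f = mk g :=
  Quotient.sound h

theorem mk_ofEq {C : Type u} [Category.{v} C] {A B : Brauer C} (h : A = B) :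
    mk (Diagram.ofEq h) = eqToHom h := by
  subst h
  rfl

theorem mk_comp {C : Type u} [Category.{v} C] {A B D : Brauer C} (f : Diagram A B)
    (g : Diagram B D) : mk (Diagram.comp f g) = mk f ≫ mk g :=
  rfl

/-- Tensor product of morphisms. -/
def tensHom {C : Type u} [Category.{v} C] {A A' B B' : Brauer C} (f : A ⟶ A') (g : B ⟶ B') :
    A.tensor B ⟶ A'.tensor B' :=
  Quotient.map₂ Diagram.tens (fun _ _ hf _ _ hg => Rel.tens_congr hf hg) f g

theorem mk_tens {C : Type u} [Category.{v} C] {A A' B B' : Brauer C} (f : Diagram A A')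
    (g : Diagram B B') : mk (Diagram.tens f g) = tensHom (mk f) (mk g) :=
  rfl

/-- The structural data: tensor product of objects is concatenation, and all the structural
isomorphisms are identities, transported along equalities of sequences. -/
instance monoidalStruct {C : Type u} [Category.{v} C] : MonoidalCategoryStruct (Brauer C) where
  tensorObj := tensor
  whiskerLeft A _ _ f := tensHom (𝟙 A) f
  whiskerRight f B := tensHom f (𝟙 B)
  tensorHom := tensHom
  tensorUnit := unit C
  associator A B D := eqToIso (tensor_assoc A B D)
  leftUnitor A := eqToIso (unit_tensor A)
  rightUnitor A := eqToIso (tensor_unit A)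

theorem tensHom_id_id {C : Type u} [Category.{v} C] (A B : Brauer C) :
    tensHom (𝟙 A) (𝟙 B) = 𝟙 (A.tensor B) :=
  sound (Rel.tens_id A B)

theorem tensHom_eqToHom {C : Type u} [Category.{v} C] {A A' B B' : Brauer C} (h : A = A')
    (h' : B = B') : tensHom (eqToHom h) (eqToHom h') = eqToHom (by rw [h, h']) := by
  subst h h'
  exact tensHom_id_id A B

instance monoidal {C : Type u} [Category.{v} C] : MonoidalCategory (Brauer C) :=
  MonoidalCategory.ofTensorHom
    (id_tensorHom_id := tensHom_id_id)
    (id_tensorHom := fun _ _ _ _ => rfl)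
    (tensorHom_id := fun _ _ => rfl)
    (tensorHom_comp_tensorHom := by
      rintro A A' A'' B B' B'' ⟨f⟩ ⟨f'⟩ ⟨g⟩ ⟨g'⟩
      exact sound (Rel.tens_comp _ _ _ _))
    (associator_naturality := by
      rintro A₁ A₂ A₃ B₁ B₂ B₃ ⟨f⟩ ⟨g⟩ ⟨h⟩
      have := sound (Rel.tens_assoc f g h)
      rw [mk_comp, mk_comp, mk_ofEq, mk_ofEq] at this
      exact this)
    (leftUnitor_naturality := by
      rintro A B ⟨f⟩
      have := sound (Rel.unit_tens f)
      rw [mk_comp, mk_comp, mk_ofEq, mk_ofEq] at this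
      exact this)
    (rightUnitor_naturality := by
      rintro A B ⟨f⟩
      have := sound (Rel.tens_unit f)
      rw [mk_comp, mk_comp, mk_ofEq, mk_ofEq] at this
      exact this)
    (pentagon := by
      intro A B D E
      change tensHom (eqToHom (tensor_assoc A B D)) (eqToHom rfl) ≫
        eqToHom (tensor_assoc A (B.tensor D) E) ≫
          tensHom (eqToHom rfl) (eqToHom (tensor_assoc B D E)) =
        eqToHom (tensor_assoc (A.tensor B) D E) ≫ eqToHom (tensor_assoc A B (D.tensor E))
      rw [tensHom_eqToHom, tensHom_eqToHom]
      simp only [eqToHom_trans])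
    (triangle := by
      intro A B
      change eqToHom (tensor_assoc A (unit C) B) ≫
          tensHom (eqToHom rfl) (eqToHom (unit_tensor B)) =
        tensHom (eqToHom (tensor_unit A)) (eqToHom rfl)
      rw [tensHom_eqToHom, tensHom_eqToHom]
      simp only [eqToHom_trans])

/-- The crossing of two groups of strands, as an isomorphism. -/
def crossIso {C : Type u} [Category.{v} C] (A B : Brauer C) : A ⊗ B ≅ B ⊗ A where
  hom := mk (Diagram.cross A B)
  inv := mk (Diagram.cross B A)
  hom_inv_id := sound (Rel.cross_cross A B)
  inv_hom_id := sound (Rel.cross_cross B A)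

theorem crossIso_hexagon {C : Type u} [Category.{v} C] (A B D : Brauer C) :
    (α_ A B D).hom ≫ (crossIso A (B ⊗ D)).hom ≫ (α_ B D A).hom =
      ((crossIso A B).hom ▷ D) ≫ (α_ B A D).hom ≫ (B ◁ (crossIso A D).hom) := by
  have := sound (Rel.hexagon A B D)
  simp only [mk_comp, mk_ofEq, mk_tens] at this
  exact this

/-- The symmetric structure given by the crossings. -/
instance symmetric {C : Type u} [Category.{v} C] : SymmetricCategory (Brauer C) where
  braiding := crossIso
  braiding_naturality_right := by
    rintro A B D ⟨f⟩
    exact sound (Rel.cross_natural (Diagram.id A) f)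
  braiding_naturality_left := by
    rintro A B ⟨f⟩ D
    exact sound (Rel.cross_natural f (Diagram.id D))
  hexagon_forward := crossIso_hexagon
  hexagon_reverse := by
    intro A B D
    have key := congrArg Iso.inv (Iso.ext
      (α := (α_ D A B) ≪≫ crossIso D (A ⊗ B) ≪≫ (α_ A B D))
      (β := whiskerRightIso (crossIso D A) B ≪≫ (α_ A D B) ≪≫ whiskerLeftIso A (crossIso D B))
      (crossIso_hexagon D A B))
    simp only [Iso.trans_inv, Category.assoc, whiskerRightIso_inv, whiskerLeftIso_inv] at key
    exact key
  symmetry A B := (crossIso A B).hom_inv_id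

/-- The cap `X⁺ ⊗ Y⁻ ⟶ 𝟙` labelled by `β : X ⟶ Y`. -/
def cap {C : Type u} [Category.{v} C] {X Y : C} (β : X ⟶ Y) :
    (pos X ⊗ neg Y : Brauer C) ⟶ 𝟙_ (Brauer C) :=
  mk (Diagram.cap β)

/-- The cup `𝟙 ⟶ X⁻ ⊗ Y⁺` labelled by `β : X ⟶ Y`. -/
def cup {C : Type u} [Category.{v} C] {X Y : C} (β : X ⟶ Y) :
    𝟙_ (Brauer C) ⟶ (neg X ⊗ pos Y : Brauer C) :=
  mk (Diagram.cup β)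

/-- The natural functor from `C` to its Brauer envelope, `X ↦ X⁺` and `β ↦ β₊`. -/
def incl (C : Type u) [Category.{v} C] : C ⥤ Brauer C where
  obj X := pos X
  map β := mk (Diagram.up β)
  map_id X := sound (Rel.up_id X)
  map_comp β γ := (sound (Rel.up_comp β γ)).symm

end Brauer

/-- A monoidal category is strict if tensor product of objects is strictly associative and
unital and the associators and unitors are identities. -/
structure IsStrictMonoidal (D : Type u) [Category.{v} D] [MonoidalCategory D] : Prop where
  tensor_assoc : ∀ A B E : D, (A ⊗ B) ⊗ E = A ⊗ (B ⊗ E)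
  unit_tensor : ∀ A : D, 𝟙_ D ⊗ A = A
  tensor_unit : ∀ A : D, A ⊗ 𝟙_ D = A
  associator_hom : ∀ A B E : D, (α_ A B E).hom = eqToHom (tensor_assoc A B E)
  leftUnitor_hom : ∀ A : D, (λ_ A).hom = eqToHom (unit_tensor A)
  rightUnitor_hom : ∀ A : D, (ρ_ A).hom = eqToHom (tensor_unit A)

/-- A strict symmetric monoidal functor: it preserves the unit, tensor products of objects and
of morphisms, and the symmetry on the nose. -/
structure IsStrictSymmetricMonoidal {B : Type u} [Category.{v} B] [MonoidalCategory B]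
    [SymmetricCategory B] {D : Type u'} [Category.{v'} D] [MonoidalCategory D]
    [SymmetricCategory D] (G : B ⥤ D) : Prop where
  obj_unit : G.obj (𝟙_ B) = 𝟙_ D
  obj_tensor : ∀ A A' : B, G.obj (A ⊗ A') = G.obj A ⊗ G.obj A'
  map_tensor : ∀ {A A' E E' : B} (f : A ⟶ E) (g : A' ⟶ E'),
    G.map (f ⊗ₘ g) =
      eqToHom (obj_tensor A A') ≫ (G.map f ⊗ₘ G.map g) ≫ eqToHom (obj_tensor E E').symm
  map_braiding : ∀ A A' : B,
    G.map (β_ A A').hom =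
      eqToHom (obj_tensor A A') ≫ (β_ (G.obj A) (G.obj A')).hom ≫ eqToHom (obj_tensor A' A).symm

/-- A strict symmetric monoidal functor `G` on the Brauer envelope of `C` respects chosen duals:
it takes `X⁻` to the chosen dual of `G(X⁺)`, and the identity cap and cup of `X` to the evaluation
and the coevaluation of that dual. -/
structure RespectsDuals {C : Type u} [Category.{v} C] {D : Type u'} [Category.{v'} D]
    [MonoidalCategory D] [SymmetricCategory D] [LeftRigidCategory D] {G : Brauer C ⥤ D}
    (hG : IsStrictSymmetricMonoidal G) : Prop where
  obj_neg : ∀ X : C, G.obj (Brauer.neg X) = ᘁ(G.obj (Brauer.pos X))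
  map_cap : ∀ X : C,
    G.map (Brauer.cap (𝟙 X)) =
      eqToHom ((hG.obj_tensor _ _).trans (by rw [obj_neg X])) ≫
        ε_ (ᘁ(G.obj (Brauer.pos X))) (G.obj (Brauer.pos X)) ≫ eqToHom hG.obj_unit.symm
  map_cup : ∀ X : C,
    G.map (Brauer.cup (𝟙 X)) =
      eqToHom hG.obj_unit ≫ η_ (ᘁ(G.obj (Brauer.pos X))) (G.obj (Brauer.pos X)) ≫
        eqToHom (Eq.trans (by rw [obj_neg X]) (hG.obj_tensor _ _).symm)

/-- A monoidal natural isomorphism between strict monoidal functors. -/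
structure IsMonoidalIso {B : Type u} [Category.{v} B] [MonoidalCategory B]
    [SymmetricCategory B] {D : Type u'} [Category.{v'} D] [MonoidalCategory D]
    [SymmetricCategory D] {G H : B ⥤ D} (hG : IsStrictSymmetricMonoidal G)
    (hH : IsStrictSymmetricMonoidal H) (θ : G ≅ H) : Prop where
  app_unit : θ.hom.app (𝟙_ B) = eqToHom (hG.obj_unit.trans hH.obj_unit.symm)
  app_tensor : ∀ A A' : B,
    θ.hom.app (A ⊗ A') =
      eqToHom (hG.obj_tensor A A') ≫ (θ.hom.app A ⊗ₘ θ.hom.app A') ≫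
        eqToHom (hH.obj_tensor A A').symm

/-! Rigidity: every sequence is a tensor product of one-term sequences, and duals multiply in
reverse order. The zigzag relations pair `X⁻` with `X⁺`, and the symmetry turns left duals into
right duals.

Faithfulness is the claim that needs a model, since the relations must be shown not to identify too
much. In the category of sets and relations every set is its own dual. Send both `X⁺` and `X⁻` to
the set of arrows into `X`, `β₊` to the graph of postcomposition with `β`, and `β₋` to the converse
graph. The relation so attached to a diagram depends only on its class (`Rel.rel_iff`), and at the
identity of `X` the relation of `β₊` returns `β`.

Universal property: recursion on diagrams defines the extension, with `β₋` going to the mate of `F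
β`, and each generating relation becomes an identity in `D` (`extendMap_rel`). Uniqueness rests on
`hom_induction`: absorption reduces labelled caps and cups to identity ones and forces `β₋` to be
the mate of `β₊` (`mk_down`), so the `β₊`, the crossings and the identity caps and cups generate.

Natural isomorphisms: a monoidal isomorphism preserves evaluations, so its component at `X⁻` must be
the mate of the inverse of its component at `X⁺` (`eq_leftDualMapIso_hom`). Conversely, with this
choice the squares at caps and cups commute.

Strictness gives equalities of objects that are rarely definitional. `ArrowEq` compares morphisms
across them, and under it all `eqToHom` factors disappear. -/

/-- Equality of two morphisms whose sources and targets are only propositionally equal. -/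
inductive ArrowEq {D : Type u} [Category.{v} D] {A B : D} (f : A ⟶ B) :
    ∀ {A' B' : D}, (A' ⟶ B') → Prop
  | self : ArrowEq f f

infix:50 " ≋ " => ArrowEq

/-! ### Calculus of morphisms up to transport of their endpoints -/

namespace ArrowEq

section Category

variable {D : Type u} [Category.{v} D]

theorem ofEq {A B : D} {f g : A ⟶ B} (h : f = g) : f ≋ g := by
  subst h
  exact self

theorem symm {A B A' B' : D} {f : A ⟶ B} {g : A' ⟶ B'} (h : f ≋ g) : g ≋ f := by
  cases h
  exact self

theorem trans {A B A' B' A'' B'' : D} {f : A ⟶ B} {g : A' ⟶ B'} {k : A'' ⟶ B''}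
    (h : f ≋ g) (h' : g ≋ k) : f ≋ k := by
  cases h
  exact h'

/-- Chains of comparisons through changing endpoints end here: once the endpoints agree again, an
honest equality results. -/
theorem eq {A B : D} {f g : A ⟶ B} (h : f ≋ g) : f = g := by
  cases h
  rfl

theorem comp {A B E A' B' E' : D} {f : A ⟶ B} {g : B ⟶ E} {f' : A' ⟶ B'} {g' : B' ⟶ E'}
    (h : f ≋ f') (h' : g ≋ g') : f ≫ g ≋ f' ≫ g' := by
  cases h
  cases h'
  exact self

theorem id_congr {A B : D} (h : A = B) : 𝟙 A ≋ 𝟙 B := by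
  subst h
  exact self

theorem eqToHom_congr {A B A' B' : D} (h : A = B) (h' : A' = B') (hA : A = A') :
    eqToHom h ≋ eqToHom h' := by
  subst h h' hA
  exact self

theorem eqToHom_id {A B : D} (h : A = B) : eqToHom h ≋ 𝟙 A := by
  subst h
  exact self

theorem eqToHom_comp {A B E : D} (h : A = B) (f : B ⟶ E) :
    eqToHom h ≫ f ≋ f := by
  subst h
  exact ofEq (Category.id_comp f)

theorem comp_eqToHom {A B E : D} (f : A ⟶ B) (h : B = E) :
    f ≫ eqToHom h ≋ f := by
  subst h
  exact ofEq (Category.comp_id f)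

theorem eqToHom_comp_eqToHom {A A' B B' : D} (h : A = A') (f : A' ⟶ B') (h' : B' = B) :
    eqToHom h ≫ f ≫ eqToHom h' ≋ f :=
  (eqToHom_comp _ _).trans (comp_eqToHom _ _)

theorem eq_conj {A A' B B' : D} {f : A ⟶ B} {g : A' ⟶ B'} (h : f ≋ g) (hA : A = A')
    (hB : B' = B) :
    f = eqToHom hA ≫ g ≫ eqToHom hB :=
  (h.trans (eqToHom_comp_eqToHom hA g hB).symm).eq

theorem map {E : Type u'} [Category.{v'} E] (G : D ⥤ E) {A B A' B' : D} {f : A ⟶ B}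
    {g : A' ⟶ B'} (h : f ≋ g) : G.map f ≋ G.map g := by
  cases h
  exact self

theorem isoInv {A B A' B' : D} {i : A ≅ B} {j : A' ≅ B'} (h : i.hom ≋ j.hom) (hA : A = A')
    (hB : B = B') : i.inv ≋ j.inv := by
  subst hA hB
  rw [Iso.ext h.eq]
  exact self

theorem of_functor_eq {E : Type u'} [Category.{v'} E] {F G : D ⥤ E} (h : F = G) {A B : D}
    (f : A ⟶ B) : F.map f ≋ G.map f := by
  subst h
  exact self

end Category

section Monoidal

variable {D : Type u} [Category.{v} D] [MonoidalCategory D]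

theorem tensorHom {A B E F A' B' E' F' : D} {f : A ⟶ B} {g : E ⟶ F} {f' : A' ⟶ B'}
    {g' : E' ⟶ F'} (h : f ≋ f') (h' : g ≋ g') : f ⊗ₘ g ≋ f' ⊗ₘ g' := by
  cases h
  cases h'
  exact self

theorem braiding [BraidedCategory D] {A A' B B' : D} (hA : A = A') (hB : B = B') :
    (β_ A B).hom ≋ (β_ A' B').hom := by
  subst hA hB
  exact self

end Monoidal

end ArrowEq

/-! ### Strict monoidal categories, strict functors and exact pairings -/

namespace IsStrictMonoidal

open ArrowEq

variable {D : Type u} [Category.{v} D] [MonoidalCategory D]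

theorem associator_inv_arrowEq (hD : IsStrictMonoidal D) (A B E : D) :
    (α_ A B E).inv ≋ 𝟙 (A ⊗ B ⊗ E) := by
  have h : (α_ A B E).inv = eqToHom (hD.tensor_assoc A B E).symm := by
    rw [← cancel_epi (α_ A B E).hom, Iso.hom_inv_id, hD.associator_hom, eqToHom_trans,
      eqToHom_refl]
  rw [h]
  exact eqToHom_id _

theorem leftUnitor_hom_arrowEq (hD : IsStrictMonoidal D) (A : D) : (λ_ A).hom ≋ 𝟙 A := by
  rw [hD.leftUnitor_hom]
  exact (eqToHom_id _).trans (id_congr (hD.unit_tensor A))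

theorem leftUnitor_inv_arrowEq (hD : IsStrictMonoidal D) (A : D) : (λ_ A).inv ≋ 𝟙 A :=
  isoInv (j := Iso.refl A) (hD.leftUnitor_hom_arrowEq A) (hD.unit_tensor A) rfl

theorem rightUnitor_hom_arrowEq (hD : IsStrictMonoidal D) (A : D) : (ρ_ A).hom ≋ 𝟙 A := by
  rw [hD.rightUnitor_hom]
  exact (eqToHom_id _).trans (id_congr (hD.tensor_unit A))

theorem rightUnitor_inv_arrowEq (hD : IsStrictMonoidal D) (A : D) : (ρ_ A).inv ≋ 𝟙 A :=
  isoInv (j := Iso.refl A) (hD.rightUnitor_hom_arrowEq A) (hD.tensor_unit A) rfl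

theorem tensorHom_assoc (hD : IsStrictMonoidal D) {A A' B B' E E' : D} (f : A ⟶ A')
    (g : B ⟶ B') (h : E ⟶ E') : (f ⊗ₘ g) ⊗ₘ h ≋ f ⊗ₘ (g ⊗ₘ h) := by
  have := associator_naturality f g h
  rw [hD.associator_hom, hD.associator_hom] at this
  exact (comp_eqToHom _ _).symm.trans ((ofEq this).trans (eqToHom_comp _ _))

theorem unit_tensorHom (hD : IsStrictMonoidal D) {A A' : D} (f : A ⟶ A') :
    𝟙 (𝟙_ D) ⊗ₘ f ≋ f := by
  have := leftUnitor_naturality f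
  rw [hD.leftUnitor_hom, hD.leftUnitor_hom, ← id_tensorHom] at this
  exact (comp_eqToHom _ _).symm.trans ((ofEq this).trans (eqToHom_comp _ _))

theorem tensorHom_unit (hD : IsStrictMonoidal D) {A A' : D} (f : A ⟶ A') :
    f ⊗ₘ 𝟙 (𝟙_ D) ≋ f := by
  have := rightUnitor_naturality f
  rw [hD.rightUnitor_hom, hD.rightUnitor_hom, ← tensorHom_id] at this
  exact (comp_eqToHom _ _).symm.trans ((ofEq this).trans (eqToHom_comp _ _))

/-- The first triangle identity of an exact pairing in a strict monoidal category. -/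
theorem coevaluation_evaluation (hD : IsStrictMonoidal D) (X Y : D) [ExactPairing X Y] :
    (𝟙 Y ⊗ₘ η_ X Y) ≫ eqToHom (hD.tensor_assoc Y X Y).symm ≫ (ε_ X Y ⊗ₘ 𝟙 Y) ≋ 𝟙 Y := by
  have h := ExactPairing.coevaluation_evaluation X Y
  rw [← id_tensorHom, ← tensorHom_id] at h
  refine ((self.comp (((eqToHom_id _).trans (hD.associator_inv_arrowEq Y X Y).symm).comp
    self)).trans (ofEq h)).trans ?_
  exact ((hD.rightUnitor_hom_arrowEq Y).comp (hD.leftUnitor_inv_arrowEq Y)).trans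
    (ofEq (Category.id_comp _))

/-- The second triangle identity of an exact pairing in a strict monoidal category. -/
theorem evaluation_coevaluation (hD : IsStrictMonoidal D) (X Y : D) [ExactPairing X Y] :
    (η_ X Y ⊗ₘ 𝟙 X) ≫ eqToHom (hD.tensor_assoc X Y X) ≫ (𝟙 X ⊗ₘ ε_ X Y) ≋ 𝟙 X := by
  have h := ExactPairing.evaluation_coevaluation X Y
  rw [← id_tensorHom, ← tensorHom_id] at h
  refine ((self.comp ((ofEq (hD.associator_hom X Y X).symm).comp self)).trans (ofEq h)).trans ?_
  exact ((hD.leftUnitor_hom_arrowEq X).comp (hD.rightUnitor_inv_arrowEq X)).trans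
    (ofEq (Category.id_comp _))

/-- An exact pairing in a strict monoidal category, from strict triangle identities. -/
@[reducible]
def exactPairing (hD : IsStrictMonoidal D) {X Y : D} (η : 𝟙_ D ⟶ X ⊗ Y) (ε : Y ⊗ X ⟶ 𝟙_ D)
    (h : (𝟙 Y ⊗ₘ η) ≫ eqToHom (hD.tensor_assoc Y X Y).symm ≫ (ε ⊗ₘ 𝟙 Y) ≋ 𝟙 Y)
    (h' : (η ⊗ₘ 𝟙 X) ≫ eqToHom (hD.tensor_assoc X Y X) ≫ (𝟙 X ⊗ₘ ε) ≋ 𝟙 X) :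
    ExactPairing X Y where
  coevaluation' := η
  evaluation' := ε
  coevaluation_evaluation' := by
    rw [← id_tensorHom, ← tensorHom_id]
    refine ((self.comp (((hD.associator_inv_arrowEq Y X Y).trans
      (eqToHom_id _).symm).comp self)).trans (h.trans ?_)).eq
    exact (((hD.rightUnitor_hom_arrowEq Y).comp (hD.leftUnitor_inv_arrowEq Y)).trans
      (ofEq (Category.id_comp _))).symm
  evaluation_coevaluation' := by
    rw [← id_tensorHom, ← tensorHom_id]
    refine ((self.comp ((ofEq (hD.associator_hom X Y X)).comp self)).trans (h'.trans ?_)).eq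
    exact (((hD.leftUnitor_hom_arrowEq X).comp (hD.rightUnitor_inv_arrowEq X)).trans
      (ofEq (Category.id_comp _))).symm

end IsStrictMonoidal

namespace IsStrictSymmetricMonoidal

open ArrowEq

variable {B : Type u} [Category.{v} B] [MonoidalCategory B] [SymmetricCategory B] {D : Type u'}
  [Category.{v'} D] [MonoidalCategory D] [SymmetricCategory D] {G : B ⥤ D}

theorem map_tensorHom (hG : IsStrictSymmetricMonoidal G) {A A' E E' : B} (f : A ⟶ E)
    (g : A' ⟶ E') : G.map (f ⊗ₘ g) ≋ G.map f ⊗ₘ G.map g := by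
  rw [hG.map_tensor]
  exact eqToHom_comp_eqToHom _ _ _

theorem map_braiding_arrowEq (hG : IsStrictSymmetricMonoidal G) (A A' : B) :
    G.map (β_ A A').hom ≋ (β_ (G.obj A) (G.obj A')).hom := by
  rw [hG.map_braiding]
  exact eqToHom_comp_eqToHom _ _ _

/-- The image of an exact pairing under a strict symmetric monoidal functor. -/
@[reducible]
def mapExactPairing (hG : IsStrictSymmetricMonoidal G) (hB : IsStrictMonoidal B)
    (hD : IsStrictMonoidal D) (X Y : B) [ExactPairing X Y] :
    ExactPairing (G.obj X) (G.obj Y) :=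
  hD.exactPairing (eqToHom hG.obj_unit.symm ≫ G.map (η_ X Y) ≫ eqToHom (hG.obj_tensor X Y))
    (eqToHom (hG.obj_tensor Y X).symm ≫ G.map (ε_ X Y) ≫ eqToHom hG.obj_unit)
    (by
      -- The image under `G` of the triangle identity in `B` is matched factor by factor with the
      -- one required in `D`.
      refine ArrowEq.trans ?_ (((hB.coevaluation_evaluation X Y).map G).trans
        (ofEq (G.map_id Y)))
      rw [G.map_comp, G.map_comp, eqToHom_map]
      refine comp ?_ (comp ?_ ?_)
      · exact (tensorHom (ofEq (G.map_id Y).symm) (eqToHom_comp_eqToHom _ _ _)).trans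
          (hG.map_tensorHom _ _).symm
      · exact eqToHom_congr _ _ (by rw [hG.obj_tensor, hG.obj_tensor])
      · exact (tensorHom (eqToHom_comp_eqToHom _ _ _) (ofEq (G.map_id Y).symm)).trans
          (hG.map_tensorHom _ _).symm)
    (by
      refine ArrowEq.trans ?_ (((hB.evaluation_coevaluation X Y).map G).trans
        (ofEq (G.map_id X)))
      rw [G.map_comp, G.map_comp, eqToHom_map]
      refine comp ?_ (comp ?_ ?_)
      · exact (tensorHom (eqToHom_comp_eqToHom _ _ _) (ofEq (G.map_id X).symm)).trans
          (hG.map_tensorHom _ _).symm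
      · exact eqToHom_congr _ _ (by rw [hG.obj_tensor, hG.obj_tensor])
      · exact (tensorHom (ofEq (G.map_id X).symm) (eqToHom_comp_eqToHom _ _ _)).trans
          (hG.map_tensorHom _ _).symm)

end IsStrictSymmetricMonoidal

/-! ### Strictness and rigidity of the Brauer envelope -/

namespace Brauer

variable {C : Type u}

/-- The one-term sequence of a signed object. -/
def gen (a : C × BrauerSign) : Brauer C := [a]

@[elab_as_elim]
theorem induction {P : Brauer C → Prop} (unit : P (unit C))
    (cons : ∀ (a : C × BrauerSign) (A : Brauer C), P A → P ((gen a).tensor A)) (A : Brauer C) :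
    P A :=
  List.rec (motive := fun A => P A) unit cons A

theorem dual_tensor (A B : Brauer C) : (A.tensor B).dual = B.dual.tensor A.dual := by
  have h (l m : List (C × BrauerSign)) :
      (l ++ m).reverse.map (fun a => (a.1, a.2.flip)) =
        m.reverse.map (fun a => (a.1, a.2.flip)) ++ l.reverse.map (fun a => (a.1, a.2.flip)) := by
    rw [List.reverse_append, List.map_append]
  exact h A B

variable [Category.{v} C]

theorem isStrictMonoidal (C : Type u) [Category.{v} C] : IsStrictMonoidal (Brauer C) where
  tensor_assoc := tensor_assoc
  unit_tensor := unit_tensor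
  tensor_unit := tensor_unit
  associator_hom _ _ _ := rfl
  leftUnitor_hom _ := rfl
  rightUnitor_hom _ := rfl

/-- This is the zigzag relation once the transports along the unit laws at both ends are dropped. -/
theorem coevaluation_evaluation_pos (X : C) :
    (𝟙 (pos X) ⊗ₘ cup (𝟙 X)) ≫
      eqToHom ((isStrictMonoidal C).tensor_assoc (pos X) (neg X) (pos X)).symm ≫
        (cap (𝟙 X) ⊗ₘ 𝟙 (pos X)) ≋ 𝟙 (pos X) := by
  have h := sound (Rel.zigzag_pos X)
  simp only [mk_comp, mk_ofEq] at h
  refine ArrowEq.trans ?_ (ArrowEq.ofEq h)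
  exact ((ArrowEq.eqToHom_comp _ _).trans
    (ArrowEq.self.comp (ArrowEq.self.comp (ArrowEq.comp_eqToHom _ _)))).symm

theorem evaluation_coevaluation_neg (X : C) :
    (cup (𝟙 X) ⊗ₘ 𝟙 (neg X)) ≫
      eqToHom ((isStrictMonoidal C).tensor_assoc (neg X) (pos X) (neg X)) ≫
        (𝟙 (neg X) ⊗ₘ cap (𝟙 X)) ≋ 𝟙 (neg X) := by
  have h := sound (Rel.zigzag_neg X)
  simp only [mk_comp, mk_ofEq] at h
  refine ArrowEq.trans ?_ (ArrowEq.ofEq h)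
  exact ((ArrowEq.eqToHom_comp _ _).trans
    (ArrowEq.self.comp (ArrowEq.self.comp (ArrowEq.comp_eqToHom _ _)))).symm

/-- `X⁻` is left dual to `X⁺` by means of the identity cap and cup. -/
instance exactPairingNegPos (X : C) : ExactPairing (neg X) (pos X) :=
  (isStrictMonoidal C).exactPairing (cup (𝟙 X)) (cap (𝟙 X)) (coevaluation_evaluation_pos X)
    (evaluation_coevaluation_neg X)

/-- For `X⁻` the pairing is that of `X⁺` composed with the symmetry. -/
theorem nonempty_exactPairing_dual_gen (a : C × BrauerSign) :
    Nonempty (ExactPairing (gen a).dual (gen a)) := by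
  obtain ⟨X, _ | _⟩ := a
  · exact ⟨exactPairingNegPos X⟩
  · exact ⟨BraidedCategory.exactPairing_swap (neg X) (pos X)⟩

/-- Pairings of one-term sequences are nested inside one another. Mere existence suffices here, as
the pairing given by the cap and the cup is recorded separately in `exactPairingNegPos`. -/
theorem nonempty_exactPairing_dual (A : Brauer C) : Nonempty (ExactPairing A.dual A) := by
  induction A using induction with
  | unit => exact ⟨(inferInstance : ExactPairing (𝟙_ (Brauer C)) (𝟙_ (Brauer C)))⟩
  | cons a A ih =>
    obtain ⟨p⟩ := ih
    obtain ⟨q⟩ := nonempty_exactPairing_dual_gen a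
    rw [dual_tensor]
    exact ⟨(inferInstance : ExactPairing (A.dual ⊗ (gen a).dual) (gen a ⊗ A))⟩

/-- The rigid structure in which both duals of a sequence are its dual sequence. -/
@[reducible]
noncomputable def rigid : RigidCategory (Brauer C) where
  rightDual A := @HasRightDual.mk _ _ _ A A.dual
    (@BraidedCategory.exactPairing_swap _ _ _ _ _ _ (nonempty_exactPairing_dual A).some)
  leftDual A := @HasLeftDual.mk _ _ _ A A.dual (nonempty_exactPairing_dual A).some

end Brauer

/-! ### Faithfulness: diagrams as relations between lists of arrows -/

namespace Brauer

variable {C : Type u} [Category.{v} C]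

/-- Generalized elements of the objects of `C`. -/
abbrev Elem (C : Type u) [Category.{v} C] : Type max u v := Σ X W : C, W ⟶ X

/-- A list of generalized elements of the objects in a sequence. -/
def Typed (A : Brauer C) (l : List (Elem C)) : Prop :=
  l.map Sigma.fst = List.map Prod.fst (A : List (C × BrauerSign))

/-- The image of a generalized element under a morphism. -/
def Sends {X Y : C} (β : X ⟶ Y) (a b : Elem C) : Prop :=
  ∃ (W : C) (f : W ⟶ X), a = ⟨X, W, f⟩ ∧ b = ⟨Y, W, f ≫ β⟩

/-- The relation on lists of generalized elements defined by a diagram. -/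
def Diagram.rel : ∀ {A B : Brauer C}, Diagram A B → List (Elem C) → List (Elem C) → Prop
  | _, _, .id A, l, m => Typed A l ∧ l = m
  | _, _, .comp f g, l, n => ∃ m, f.rel l m ∧ g.rel m n
  | _, _, .tens f g, l, m => ∃ l₁ l₂ m₁ m₂, l = l₁ ++ l₂ ∧ m = m₁ ++ m₂ ∧ f.rel l₁ m₁ ∧ g.rel l₂ m₂
  | _, _, .cross A B, l, m => ∃ l₁ l₂, l = l₁ ++ l₂ ∧ m = l₂ ++ l₁ ∧ Typed A l₁ ∧ Typed B l₂
  | _, _, .up β, l, m => ∃ a b, l = [a] ∧ m = [b] ∧ Sends β a b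
  | _, _, .down β, l, m => ∃ a b, l = [b] ∧ m = [a] ∧ Sends β a b
  | _, _, .cap β, l, m => ∃ a b, l = [a, b] ∧ m = [] ∧ Sends β a b
  | _, _, .cup β, l, m => ∃ a b, l = [] ∧ m = [a, b] ∧ Sends β a b

theorem Diagram.rel_ofEq {A B : Brauer C} (h : A = B) (l m : List (Elem C)) :
    (Diagram.ofEq h).rel l m ↔ Typed A l ∧ l = m := by
  subst h
  rfl

theorem Typed.append {A B : Brauer C} {l m : List (Elem C)} (hl : Typed A l) (hm : Typed B m) :
    Typed (A.tensor B) (l ++ m) := by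
  have h : (l ++ m).map Sigma.fst = List.map Prod.fst A ++ List.map Prod.fst B := by
    rw [List.map_append, ← show _ = _ from hl, ← show _ = _ from hm]
  exact h.trans (List.map_append (f := Prod.fst) (l₁ := A) (l₂ := B)).symm

theorem Typed.length_eq {A : Brauer C} {l : List (Elem C)} (hl : Typed A l) :
    l.length = List.length (A : List (C × BrauerSign)) := by
  exact (List.length_map _).symm.trans ((congrArg List.length hl).trans (List.length_map _))

theorem Typed.split {A B : Brauer C} {l : List (Elem C)} (hl : Typed (A.tensor B) l) :
    ∃ l₁ l₂, l = l₁ ++ l₂ ∧ Typed A l₁ ∧ Typed B l₂ := by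
  have h : l.map Sigma.fst = List.map Prod.fst A ++ List.map Prod.fst B :=
    Eq.trans hl (List.map_append (f := Prod.fst) (l₁ := A) (l₂ := B))
  obtain ⟨l₁, l₂, rfl, h₁, h₂⟩ := List.map_eq_append_iff.1 h
  exact ⟨l₁, l₂, rfl, h₁, h₂⟩

/-- Concatenation stands for the cartesian product. The sequence `A` fixes the length of the first
factor, so the two factors can be recovered. -/
theorem Typed.append_inj {A : Brauer C} {l₁ l₂ m₁ m₂ : List (Elem C)} (hl : Typed A l₁)
    (hm : Typed A m₁) (h : l₁ ++ l₂ = m₁ ++ m₂) : l₁ = m₁ ∧ l₂ = m₂ :=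
  List.append_inj h (hl.length_eq.trans hm.length_eq.symm)

theorem typed_unit {l : List (Elem C)} : Typed (unit C) l ↔ l = [] := by
  exact List.map_eq_nil_iff (f := Sigma.fst)

theorem typed_pos {X : C} {l : List (Elem C)} :
    Typed (pos X) l ↔ ∃ (W : C) (f : W ⟶ X), l = [⟨X, W, f⟩] := by
  constructor
  · intro h
    obtain ⟨⟨Y, W, f⟩, rfl, h⟩ := List.map_eq_singleton_iff.1 (show l.map Sigma.fst = [X] from h)
    obtain rfl : Y = X := ‹_›
    exact ⟨W, f, rfl⟩
  · rintro ⟨W, f, rfl⟩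
    rfl

/-- `Typed` ignores signs: in the model `X⁺` and `X⁻` are the same set. -/
theorem typed_neg {X : C} {l : List (Elem C)} :
    Typed (neg X) l ↔ ∃ (W : C) (f : W ⟶ X), l = [⟨X, W, f⟩] :=
  typed_pos

/-- Identity diagrams relate only typed lists, so the unit laws hold only because every diagram
does. -/
theorem Diagram.rel_typed {A B : Brauer C} (f : Diagram A B) :
    ∀ {l m : List (Elem C)}, f.rel l m → Typed A l ∧ Typed B m := by
  induction f with
  | id A => rintro l _ ⟨h, rfl⟩; exact ⟨h, h⟩
  | comp f g hf hg => rintro l n ⟨m, h, h'⟩; exact ⟨(hf h).1, (hg h').2⟩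
  | tens f g hf hg =>
    rintro _ _ ⟨l₁, l₂, m₁, m₂, rfl, rfl, h, h'⟩
    exact ⟨(hf h).1.append (hg h').1, (hf h).2.append (hg h').2⟩
  | cross A B =>
    rintro _ _ ⟨l₁, l₂, rfl, rfl, h, h'⟩
    exact ⟨h.append h', h'.append h⟩
  | up β => rintro _ _ ⟨_, _, rfl, rfl, W, f, rfl, rfl⟩; exact ⟨rfl, rfl⟩
  | down β => rintro _ _ ⟨_, _, rfl, rfl, W, f, rfl, rfl⟩; exact ⟨rfl, rfl⟩
  | cap β => rintro _ _ ⟨_, _, rfl, rfl, W, f, rfl, rfl⟩; exact ⟨rfl, rfl⟩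
  | cup β => rintro _ _ ⟨_, _, rfl, rfl, W, f, rfl, rfl⟩; exact ⟨rfl, rfl⟩

theorem Sends.comp {X Y Z : C} {β : X ⟶ Y} {γ : Y ⟶ Z} {a b c : Elem C} (h : Sends β a b)
    (h' : Sends γ b c) : Sends (β ≫ γ) a c := by
  obtain ⟨W, f, rfl, rfl⟩ := h
  obtain ⟨W', f', h, rfl⟩ := h'
  cases h
  exact ⟨W, f, rfl, by rw [Category.assoc]⟩

theorem sends_comp {X Y Z : C} {β : X ⟶ Y} {γ : Y ⟶ Z} {a c : Elem C} :
    Sends (β ≫ γ) a c ↔ ∃ b, Sends β a b ∧ Sends γ b c := by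
  constructor
  · rintro ⟨W, f, rfl, rfl⟩
    exact ⟨⟨Y, W, f ≫ β⟩, ⟨W, f, rfl, rfl⟩, W, f ≫ β, rfl, by rw [Category.assoc]⟩
  · rintro ⟨b, h, h'⟩
    exact h.comp h'

theorem sends_id {X : C} {a b : Elem C} : Sends (𝟙 X) a b ↔ Typed (pos X) [a] ∧ a = b := by
  rw [typed_pos]
  constructor
  · rintro ⟨W, f, rfl, rfl⟩
    exact ⟨⟨W, f, rfl⟩, by rw [Category.comp_id]⟩
  · rintro ⟨⟨W, f, h⟩, rfl⟩
    obtain rfl := List.singleton_injective h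
    exact ⟨W, f, rfl, by rw [Category.comp_id]⟩

/-- Soundness of the model. The structural relations hold because concatenation of lists is
associative and unital with unique typed splittings. Functoriality and absorption reduce to
composition of graphs (`sends_comp`), and rigidity to the self-duality of sets. -/
theorem Rel.rel_iff {A B : Brauer C} {f g : Diagram A B} (h : Rel f g) :
    ∀ l m, f.rel l m ↔ g.rel l m := by
  induction h with
  | refl f => exact fun _ _ => Iff.rfl
  | symm _ h => exact fun l m => (h l m).symm
  | trans _ _ h h' => exact fun l m => (h l m).trans (h' l m)
  | comp_congr _ _ h h' => exact fun l m => by simp only [Diagram.rel, h, h']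
  | tens_congr _ _ h h' => exact fun l m => by simp only [Diagram.rel, h, h']
  | id_comp f =>
    intro l m
    constructor
    · rintro ⟨_, ⟨_, rfl⟩, h⟩; exact h
    · exact fun h => ⟨l, ⟨(f.rel_typed h).1, rfl⟩, h⟩
  | comp_id f =>
    intro l m
    constructor
    · rintro ⟨_, h, _, rfl⟩; exact h
    · exact fun h => ⟨m, h, (f.rel_typed h).2, rfl⟩
  | assoc f g h =>
    intro l m
    constructor
    · rintro ⟨n, ⟨k, h₁, h₂⟩, h₃⟩; exact ⟨k, h₁, n, h₂, h₃⟩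
    · rintro ⟨k, h₁, n, h₂, h₃⟩; exact ⟨n, ⟨k, h₁, h₂⟩, h₃⟩
  | tens_id A B =>
    intro l m
    constructor
    · rintro ⟨l₁, l₂, m₁, m₂, rfl, rfl, ⟨h, rfl⟩, h', rfl⟩; exact ⟨h.append h', rfl⟩
    · rintro ⟨h, rfl⟩
      obtain ⟨l₁, l₂, rfl, h₁, h₂⟩ := h.split
      exact ⟨l₁, l₂, l₁, l₂, rfl, rfl, ⟨h₁, rfl⟩, h₂, rfl⟩
  | tens_comp f f' g g' =>
    intro l m
    constructor
    · rintro ⟨_, ⟨l₁, l₂, m₁, m₂, rfl, rfl, h₁, h₂⟩, k₁, k₂, n₁, n₂, e, rfl, h₃, h₄⟩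
      -- The middle list is split once by each factor of the composite, and typing makes the two
      -- splittings agree.
      obtain ⟨rfl, rfl⟩ := (f.rel_typed h₁).2.append_inj (f'.rel_typed h₃).1 e
      exact ⟨l₁, l₂, n₁, n₂, rfl, rfl, ⟨_, h₁, h₃⟩, _, h₂, h₄⟩
    · rintro ⟨l₁, l₂, n₁, n₂, rfl, rfl, ⟨m₁, h₁, h₃⟩, m₂, h₂, h₄⟩
      exact ⟨_, ⟨l₁, l₂, m₁, m₂, rfl, rfl, h₁, h₂⟩, m₁, m₂, n₁, n₂, rfl, rfl, h₃, h₄⟩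
  | tens_assoc f g h =>
    intro l m
    simp only [Diagram.rel, Diagram.rel_ofEq]
    constructor
    · rintro ⟨_, ⟨_, l₃, _, m₃, rfl, rfl, ⟨l₁, l₂, m₁, m₂, rfl, rfl, h₁, h₂⟩, h₃⟩, _, rfl⟩
      exact ⟨_, ⟨((f.rel_typed h₁).1.append (g.rel_typed h₂).1).append (h.rel_typed h₃).1, rfl⟩,
        l₁, l₂ ++ l₃, m₁, m₂ ++ m₃, List.append_assoc .., List.append_assoc .., h₁,
        l₂, l₃, m₂, m₃, rfl, rfl, h₂, h₃⟩
    · rintro ⟨_, ⟨_, rfl⟩, l₁, _, m₁, _, rfl, rfl, h₁, l₂, l₃, m₂, m₃, rfl, rfl, h₂, h₃⟩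
      refine ⟨_, ⟨l₁ ++ l₂, l₃, m₁ ++ m₂, m₃, (List.append_assoc ..).symm, rfl,
        ⟨l₁, l₂, m₁, m₂, rfl, rfl, h₁, h₂⟩, h₃⟩,
        ((f.rel_typed h₁).2.append (g.rel_typed h₂).2).append (h.rel_typed h₃).2,
        List.append_assoc ..⟩
  | unit_tens f =>
    intro l m
    simp only [Diagram.rel, Diagram.rel_ofEq, typed_unit]
    constructor
    · rintro ⟨_, ⟨_, l, _, m, rfl, rfl, ⟨rfl, rfl⟩, h⟩, _, rfl⟩
      exact ⟨l, ⟨(f.rel_typed h).1, rfl⟩, h⟩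
    · rintro ⟨_, ⟨_, rfl⟩, h⟩
      exact ⟨m, ⟨[], l, [], m, rfl, rfl, ⟨rfl, rfl⟩, h⟩, (f.rel_typed h).2, rfl⟩
  | @tens_unit A B f =>
    intro l m
    simp only [Diagram.rel, Diagram.rel_ofEq, typed_unit, tensor_unit]
    constructor
    · rintro ⟨_, ⟨l, _, m, _, rfl, rfl, h, rfl, rfl⟩, _, rfl⟩
      exact ⟨l, ⟨by simpa using (f.rel_typed h).1, by simp⟩, by simpa using h⟩
    · rintro ⟨_, ⟨_, rfl⟩, h⟩
      exact ⟨m, ⟨l, [], m, [], by simp, by simp, h, rfl, rfl⟩, (f.rel_typed h).2, rfl⟩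
  | cross_natural f g =>
    intro l m
    constructor
    · rintro ⟨_, ⟨l₁, l₂, m₁, m₂, rfl, rfl, h₁, h₂⟩, k₁, k₂, e, rfl, t₁, t₂⟩
      obtain ⟨rfl, rfl⟩ := (f.rel_typed h₁).2.append_inj t₁ e
      exact ⟨_, ⟨l₁, l₂, rfl, rfl, (f.rel_typed h₁).1, (g.rel_typed h₂).1⟩, l₂, l₁, _, _, rfl, rfl,
        h₂, h₁⟩
    · rintro ⟨_, ⟨l₁, l₂, rfl, rfl, t₁, t₂⟩, k₂, k₁, m₂, m₁, e, rfl, h₂, h₁⟩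
      obtain ⟨rfl, rfl⟩ := t₂.append_inj (g.rel_typed h₂).1 e
      exact ⟨_, ⟨l₁, l₂, m₁, m₂, rfl, rfl, h₁, h₂⟩, m₁, m₂, rfl, rfl, (f.rel_typed h₁).2,
        (g.rel_typed h₂).2⟩
  | cross_cross A B =>
    intro l m
    constructor
    · rintro ⟨_, ⟨l₁, l₂, rfl, rfl, t₁, t₂⟩, k₂, k₁, e, rfl, t₃, t₄⟩
      obtain ⟨rfl, rfl⟩ := t₂.append_inj t₃ e
      exact ⟨t₁.append t₂, rfl⟩
    · rintro ⟨h, rfl⟩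
      obtain ⟨l₁, l₂, rfl, h₁, h₂⟩ := h.split
      exact ⟨_, ⟨l₁, l₂, rfl, rfl, h₁, h₂⟩, l₂, l₁, rfl, rfl, h₂, h₁⟩
  | hexagon A B E =>
    intro l m
    simp only [Diagram.rel, Diagram.rel_ofEq]
    constructor
    · rintro ⟨_, ⟨_, rfl⟩, _, ⟨l₁, _, rfl, rfl, t₁, t⟩, _, rfl⟩
      obtain ⟨l₂, l₃, rfl, t₂, t₃⟩ := t.split
      exact ⟨(l₂ ++ l₁) ++ l₃, ⟨l₁ ++ l₂, l₃, l₂ ++ l₁, l₃, (List.append_assoc ..).symm, rfl,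
        ⟨l₁, l₂, rfl, rfl, t₁, t₂⟩, t₃, rfl⟩, _, ⟨(t₂.append t₁).append t₃, rfl⟩,
        l₂, l₁ ++ l₃, l₂, l₃ ++ l₁, List.append_assoc .., List.append_assoc .., ⟨t₂, rfl⟩,
        l₁, l₃, rfl, rfl, t₁, t₃⟩
    · rintro ⟨_, ⟨_, l₃, _, _, rfl, rfl, ⟨l₁, l₂, rfl, rfl, t₁, t₂⟩, t₃, rfl⟩, _, ⟨_, rfl⟩,
        k₂, _, _, _, e, rfl, ⟨t₂', rfl⟩, k₁, k₃, rfl, rfl, t₁', t₃'⟩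
      rw [List.append_assoc] at e
      obtain ⟨h, e⟩ := t₂.append_inj t₂' e
      obtain ⟨rfl, rfl⟩ := t₁.append_inj t₁' e
      subst h
      exact ⟨_, ⟨(t₁.append t₂).append t₃, rfl⟩, _,
        ⟨l₁, l₂ ++ l₃, List.append_assoc .., rfl, t₁, t₂.append t₃⟩,
        (t₂.append t₃).append t₁, List.append_assoc ..⟩
  | up_id X =>
    intro l m
    simp only [Diagram.rel, sends_id]
    constructor
    · rintro ⟨a, b, rfl, rfl, h, rfl⟩; exact ⟨h, rfl⟩
    · rintro ⟨h, rfl⟩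
      obtain ⟨W, f, rfl⟩ := typed_pos.1 h
      exact ⟨_, _, rfl, rfl, h, rfl⟩
  | down_id X =>
    intro l m
    simp only [Diagram.rel, sends_id]
    constructor
    · rintro ⟨a, b, rfl, rfl, h, rfl⟩; exact ⟨h, rfl⟩
    · rintro ⟨h, rfl⟩
      obtain ⟨W, f, rfl⟩ := typed_pos.1 h
      exact ⟨_, _, rfl, rfl, h, rfl⟩
  | up_comp β γ =>
    intro l m
    simp only [Diagram.rel, sends_comp]
    constructor
    · rintro ⟨_, ⟨a, b, rfl, rfl, h⟩, b', c, e, rfl, h'⟩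
      obtain rfl := List.singleton_injective e
      exact ⟨a, c, rfl, rfl, b, h, h'⟩
    · rintro ⟨a, c, rfl, rfl, b, h, h'⟩
      exact ⟨[b], ⟨a, b, rfl, rfl, h⟩, b, c, rfl, rfl, h'⟩
  | down_comp β γ =>
    intro l m
    simp only [Diagram.rel, sends_comp]
    constructor
    · rintro ⟨_, ⟨a, b, rfl, rfl, h⟩, b', c, e, rfl, h'⟩
      obtain rfl := List.singleton_injective e
      exact ⟨b', b, rfl, rfl, a, h', h⟩
    · rintro ⟨a, c, rfl, rfl, b, h, h'⟩
      exact ⟨[b], ⟨b, c, rfl, rfl, h'⟩, a, b, rfl, rfl, h⟩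
  | cap_absorb β γ δ =>
    intro l m
    simp only [Diagram.rel, sends_comp]
    constructor
    · rintro ⟨_, ⟨_, _, _, _, rfl, rfl, ⟨a, b, rfl, rfl, h₁⟩, c, d, rfl, rfl, h₂⟩, b', c', e, rfl,
        h₃⟩
      simp only [List.cons_append, List.nil_append, List.cons.injEq, and_true] at e
      obtain ⟨rfl, rfl⟩ := e
      exact ⟨_, _, rfl, rfl, _, h₁, _, h₃, h₂⟩
    · rintro ⟨a, d, rfl, rfl, b, h₁, c, h₃, h₂⟩
      exact ⟨[b, c], ⟨[a], [d], [b], [c], rfl, rfl, ⟨_, _, rfl, rfl, h₁⟩, _, _, rfl, rfl, h₂⟩,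
        _, _, rfl, rfl, h₃⟩
  | cup_absorb β γ δ =>
    intro l m
    simp only [Diagram.rel, sends_comp]
    constructor
    · rintro ⟨_, ⟨b', c', rfl, rfl, h₃⟩, _, _, _, _, e, rfl, ⟨a, b, rfl, rfl, h₁⟩, c, d, rfl, rfl,
        h₂⟩
      simp only [List.cons_append, List.nil_append, List.cons.injEq, and_true] at e
      obtain ⟨rfl, rfl⟩ := e
      exact ⟨_, _, rfl, rfl, _, h₁, _, h₃, h₂⟩
    · rintro ⟨a, d, rfl, rfl, b, h₁, c, h₃, h₂⟩
      exact ⟨[b, c], ⟨_, _, rfl, rfl, h₃⟩, [b], [c], [a], [d], rfl, rfl, ⟨_, _, rfl, rfl, h₁⟩,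
        _, _, rfl, rfl, h₂⟩
  | zigzag_pos X =>
    intro l m
    simp only [Diagram.rel, Diagram.rel_ofEq, sends_id]
    constructor
    · rintro ⟨_, ⟨t, rfl⟩, _, ⟨l₁, _, _, _, rfl, rfl, ⟨t₁, rfl⟩, a, _, rfl, rfl, t₂, rfl⟩, _,
        ⟨_, rfl⟩, _, ⟨_, _, _, m, e, rfl, ⟨c, _, rfl, rfl, _, rfl⟩, _, rfl⟩, _, rfl⟩
      obtain ⟨W, f, rfl⟩ := typed_pos.1 t₁
      simp only [List.cons_append, List.nil_append, List.cons.injEq] at e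
      obtain ⟨rfl, rfl, rfl⟩ := e
      exact ⟨by simpa using t₁, by simp⟩
    · rintro ⟨t, rfl⟩
      obtain ⟨W, f, rfl⟩ := typed_pos.1 t
      set a : Elem C := ⟨X, W, f⟩
      -- The identity cup creates two equal entries and the identity cap tests two entries for
      -- equality, so the middle list is three copies of `a`.
      refine ⟨_, ⟨t, rfl⟩, [a, a, a], ⟨[a], [], [a], [a, a], rfl, rfl, ⟨t, rfl⟩, a, a, rfl, rfl, t,
        rfl⟩, _, ⟨t.append (typed_neg.2 (typed_pos.1 t) |>.append t), rfl⟩, [a],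
        ⟨[a, a], [a], [], [a], rfl, rfl, ⟨a, a, rfl, rfl, t, rfl⟩, t, rfl⟩, t, rfl⟩
  | zigzag_neg X =>
    intro l m
    simp only [Diagram.rel, Diagram.rel_ofEq, sends_id]
    constructor
    · rintro ⟨_, ⟨t, rfl⟩, _, ⟨_, l₁, _, _, rfl, rfl, ⟨a, _, rfl, rfl, t₂, rfl⟩, t₁, rfl⟩, _,
        ⟨_, rfl⟩, _, ⟨m, _, _, _, e, rfl, ⟨t₃, rfl⟩, c, _, rfl, rfl, _, rfl⟩, _, rfl⟩
      obtain ⟨W, f, rfl⟩ := typed_neg.1 t₁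
      obtain ⟨W, f, rfl⟩ := typed_neg.1 t₃
      simp only [List.cons_append, List.nil_append, List.cons.injEq, and_true] at e
      obtain ⟨rfl, rfl, h⟩ := e
      exact ⟨t₁, by simpa using h⟩
    · rintro ⟨t, rfl⟩
      obtain ⟨W, f, rfl⟩ := typed_neg.1 t
      set a : Elem C := ⟨X, W, f⟩
      have t' : Typed (pos X) [a] := typed_pos.2 (typed_neg.1 t)
      refine ⟨_, ⟨t, rfl⟩, [a, a, a], ⟨[], [a], [a, a], [a], rfl, rfl, ⟨a, a, rfl, rfl, t',
        rfl⟩, t, rfl⟩, _, ⟨(t.append t').append t, rfl⟩, [a],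
        ⟨[a], [a, a], [a], [], rfl, rfl, ⟨t, rfl⟩, a, a, rfl, rfl, t', rfl⟩, t, rfl⟩

theorem incl_obj_injective : Function.Injective (incl C).obj := fun X Y h => by
  have h : [(X, BrauerSign.plus)] = [(Y, BrauerSign.plus)] := h
  simpa using h

/-- As in Cayley's theorem, `β` is recovered by applying postcomposition with `β` to `𝟙 X`. -/
theorem incl_faithful : (incl C).Faithful where
  map_injective {X Y β γ} h := by
    have h : Rel (Diagram.up β) (Diagram.up γ) := Quotient.exact h
    obtain ⟨a, b, ha, hb, W, f, rfl, rfl⟩ := (h.rel_iff [⟨X, X, 𝟙 X⟩] [⟨Y, X, β⟩]).1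
      ⟨_, _, rfl, rfl, X, 𝟙 X, rfl, by rw [Category.id_comp]⟩
    cases List.singleton_injective ha
    cases List.singleton_injective hb
    exact Category.id_comp γ

end Brauer

/-! ### Mates slide around evaluations and coevaluations -/

section Mates

variable {D : Type u} [Category.{v} D] [MonoidalCategory D]

/-- This is the image in `D` of the absorption relation for caps; the dual statement below serves
cups. -/
theorem tensorHom_leftAdjointMate_comp_evaluation {W X Y Z : D} [HasLeftDual Z] [HasLeftDual W]
    (f : X ⟶ Y) (g : Y ⟶ Z) (h : Z ⟶ W) :
    (f ⊗ₘ (ᘁh)) ≫ (g ⊗ₘ 𝟙 (ᘁZ)) ≫ ε_ (ᘁZ) Z = ((f ≫ g ≫ h) ⊗ₘ 𝟙 (ᘁW)) ≫ ε_ (ᘁW) W := by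
  have := leftAdjointMate_comp_evaluation h
  rw [← id_tensorHom, ← tensorHom_id] at this
  rw [tensorHom_comp_tensorHom_assoc, Category.comp_id,
    ← Category.comp_id (f ≫ g), ← Category.id_comp (ᘁh), ← tensorHom_comp_tensorHom_assoc, this,
    tensorHom_comp_tensorHom_assoc]
  simp

theorem coevaluation_comp_tensorHom_leftAdjointMate {W X Y Z : D} [HasLeftDual X] [HasLeftDual Y]
    (f : X ⟶ Y) (g : Y ⟶ Z) (h : Z ⟶ W) :
    (η_ (ᘁY) Y ≫ (𝟙 (ᘁY) ⊗ₘ g)) ≫ ((ᘁf) ⊗ₘ h) = η_ (ᘁX) X ≫ (𝟙 (ᘁX) ⊗ₘ (f ≫ g ≫ h)) := by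
  have := coevaluation_comp_leftAdjointMate f
  rw [← id_tensorHom, ← tensorHom_id] at this
  rw [Category.assoc, tensorHom_comp_tensorHom, Category.id_comp,
    ← Category.comp_id (ᘁf), ← Category.id_comp (g ≫ h), ← tensorHom_comp_tensorHom,
    reassoc_of% this, tensorHom_comp_tensorHom]
  simp

end Mates

/-! ### Existence of the extension to a strict rigid target -/

namespace Brauer

open ArrowEq

variable {C : Type u} [Category.{v} C] {D : Type u'} [Category.{v'} D] [MonoidalCategory D]
  [LeftRigidCategory D]

/-- The value of the extension of `F` at a one-term sequence. -/
def extendGen (F : C ⥤ D) : C × BrauerSign → D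
  | (X, .plus) => F.obj X
  | (X, .minus) => ᘁ(F.obj X)

/-- The extension of `F` to sequences. -/
def extendObj (F : C ⥤ D) (A : Brauer C) : D :=
  List.foldr (fun a E => extendGen F a ⊗ E) (𝟙_ D) A

theorem extendObj_cons (F : C ⥤ D) (a : C × BrauerSign) (A : Brauer C) :
    extendObj F ((gen a).tensor A) = extendGen F a ⊗ extendObj F A :=
  rfl

theorem extendObj_tensor (hD : IsStrictMonoidal D) (F : C ⥤ D) (A B : Brauer C) :
    extendObj F (A.tensor B) = extendObj F A ⊗ extendObj F B := by
  induction A using induction with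
  | unit => exact (hD.unit_tensor _).symm
  | cons a A ih => rw [tensor_assoc, extendObj_cons, extendObj_cons, ih, hD.tensor_assoc]

/-- The fold leaves a trailing factor `𝟙_ D`, so this is an equality by strictness and not by
definition. -/
theorem extendObj_pos (hD : IsStrictMonoidal D) (F : C ⥤ D) (X : C) : extendObj F (pos X) = F.obj X :=
  hD.tensor_unit _

theorem extendObj_neg (hD : IsStrictMonoidal D) (F : C ⥤ D) (X : C) : extendObj F (neg X) = ᘁ(F.obj X) :=
  hD.tensor_unit _

variable [SymmetricCategory D] (hD : IsStrictMonoidal D) (F : C ⥤ D)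

/-- The value of the extension of `F` at a diagram. -/
def extendMap : ∀ {A B : Brauer C}, Diagram A B → (extendObj F A ⟶ extendObj F B)
  | _, _, .id _ => 𝟙 _
  | _, _, .comp f g => extendMap f ≫ extendMap g
  | _, _, .tens f g => eqToHom (extendObj_tensor hD F _ _) ≫ (extendMap f ⊗ₘ extendMap g) ≫
      eqToHom (extendObj_tensor hD F _ _).symm
  | _, _, .cross A B => eqToHom (extendObj_tensor hD F A B) ≫ (β_ _ _).hom ≫
      eqToHom (extendObj_tensor hD F B A).symm
  | _, _, .up β => eqToHom (extendObj_pos hD F _) ≫ F.map β ≫ eqToHom (extendObj_pos hD F _).symm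
  | _, _, .down β => eqToHom (extendObj_neg hD F _) ≫ (ᘁ(F.map β)) ≫
      eqToHom (extendObj_neg hD F _).symm
  -- The values at labelled caps and cups are forced: absorption writes them as an identity cap or
  -- cup composed with `β₊`.
  | _, _, .cap (X := X) (Y := Y) β =>
      eqToHom (by rw [extendObj_tensor hD F, extendObj_pos hD, extendObj_neg hD]) ≫
        (F.map β ⊗ₘ 𝟙 (ᘁ(F.obj Y))) ≫ ε_ (ᘁ(F.obj Y)) (F.obj Y)
  | _, _, .cup (X := X) (Y := Y) β =>
      (η_ (ᘁ(F.obj X)) (F.obj X) ≫ (𝟙 (ᘁ(F.obj X)) ⊗ₘ F.map β)) ≫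
        eqToHom (by rw [extendObj_tensor hD F, extendObj_pos hD, extendObj_neg hD])

theorem extendMap_tens {A A' B B' : Brauer C} (f : Diagram A A') (g : Diagram B B') :
    extendMap hD F (.tens f g) ≋ extendMap hD F f ⊗ₘ extendMap hD F g :=
  eqToHom_comp_eqToHom _ _ _

theorem extendMap_cross (A B : Brauer C) :
    extendMap hD F (.cross A B) ≋ (β_ (extendObj F A) (extendObj F B)).hom :=
  eqToHom_comp_eqToHom _ _ _

theorem extendMap_up {X Y : C} (β : X ⟶ Y) : extendMap hD F (.up β) ≋ F.map β :=
  eqToHom_comp_eqToHom _ _ _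

theorem extendMap_down {X Y : C} (β : X ⟶ Y) : extendMap hD F (.down β) ≋ (ᘁ(F.map β)) :=
  eqToHom_comp_eqToHom _ _ _

theorem extendMap_cap {X Y : C} (β : X ⟶ Y) :
    extendMap hD F (.cap β) ≋
      (F.map β ⊗ₘ 𝟙 (ᘁ(F.obj Y))) ≫ ε_ (ᘁ(F.obj Y)) (F.obj Y) :=
  eqToHom_comp _ _

theorem extendMap_cup {X Y : C} (β : X ⟶ Y) :
    extendMap hD F (.cup β) ≋
      η_ (ᘁ(F.obj X)) (F.obj X) ≫ (𝟙 (ᘁ(F.obj X)) ⊗ₘ F.map β) :=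
  comp_eqToHom _ _

theorem extendMap_cap_id (X : C) :
    extendMap hD F (.cap (𝟙 X)) ≋ ε_ (ᘁ(F.obj X)) (F.obj X) :=
  (extendMap_cap hD F (𝟙 X)).trans (ofEq (by simp))

theorem extendMap_cup_id (X : C) :
    extendMap hD F (.cup (𝟙 X)) ≋ η_ (ᘁ(F.obj X)) (F.obj X) :=
  (extendMap_cup hD F (𝟙 X)).trans (ofEq (by simp))

theorem extendMap_ofEq {A B : Brauer C} (h : A = B) :
    extendMap hD F (.ofEq h) = eqToHom (by rw [h]) := by
  subst h
  rfl

theorem extendMap_comp_ofEq {A B B' : Brauer C} (f : Diagram A B) (h : B = B') :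
    extendMap hD F (f.comp (.ofEq h)) ≋ extendMap hD F f := by
  subst h
  exact ArrowEq.ofEq (Category.comp_id _)

theorem extendMap_ofEq_comp {A A' B : Brauer C} (h : A = A') (f : Diagram A' B) :
    extendMap hD F (.comp (.ofEq h) f) ≋ extendMap hD F f := by
  subst h
  exact ArrowEq.ofEq (Category.id_comp _)

/-- Each relation becomes the corresponding axiom of `D`, functoriality of `F` and of mates, a
sliding identity for mates, or a triangle identity, after transports are discarded. -/
theorem extendMap_rel {A B : Brauer C} {f g : Diagram A B} (h : Rel f g) :
    extendMap hD F f = extendMap hD F g := by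
  induction h with
  | refl f => rfl
  | symm _ h => exact h.symm
  | trans _ _ h h' => exact h.trans h'
  | comp_congr _ _ h h' => simp only [extendMap, h, h']
  | tens_congr _ _ h h' => simp only [extendMap, h, h']
  | id_comp f => exact Category.id_comp _
  | comp_id f => exact Category.comp_id _
  | assoc f g h => exact Category.assoc _ _ _
  | tens_id A B =>
    exact ((extendMap_tens hD F (.id A) (.id B)).trans ((ofEq (id_tensorHom_id _ _)).trans
      (id_congr (extendObj_tensor hD F A B).symm))).eq
  | tens_comp f f' g g' =>
    exact (((extendMap_tens hD F f g).comp (extendMap_tens hD F f' g')).trans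
      ((ofEq (tensorHom_comp_tensorHom _ _ _ _)).trans (extendMap_tens hD F (f.comp f') (g.comp g')).symm)).eq
  | tens_assoc f g h =>
    refine ArrowEq.eq ((extendMap_comp_ofEq hD F _ _).trans (ArrowEq.trans ?_
      (extendMap_ofEq_comp hD F _ _).symm))
    exact ((extendMap_tens hD F _ _).trans ((extendMap_tens hD F _ _).tensorHom self)).trans
      ((hD.tensorHom_assoc _ _ _).trans
        ((extendMap_tens hD F _ _).trans (self.tensorHom (extendMap_tens hD F _ _))).symm)
  | unit_tens f =>
    exact ((extendMap_comp_ofEq hD F _ _).trans ((extendMap_tens hD F (.id (unit C)) f).trans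
      ((hD.unit_tensorHom _).trans (extendMap_ofEq_comp hD F _ _).symm))).eq
  | tens_unit f =>
    exact ((extendMap_comp_ofEq hD F _ _).trans ((extendMap_tens hD F f (.id _)).trans
      ((hD.tensorHom_unit _).trans (extendMap_ofEq_comp hD F _ _).symm))).eq
  | cross_natural f g =>
    exact (((extendMap_tens hD F _ _).comp (extendMap_cross hD F _ _)).trans
      ((ofEq (BraidedCategory.braiding_naturality _ _)).trans
        ((extendMap_cross hD F _ _).comp (extendMap_tens hD F _ _)).symm)).eq
  | cross_cross A B =>
    exact (((extendMap_cross hD F _ _).comp (extendMap_cross hD F _ _)).trans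
      ((ofEq (SymmetricCategory.symmetry _ _)).trans
        (id_congr (extendObj_tensor hD F A B).symm))).eq
  | hexagon A B E =>
    have key := BraidedCategory.hexagon_forward (extendObj F A) (extendObj F B) (extendObj F E)
    rw [← id_tensorHom, ← tensorHom_id] at key
    -- Both sides are transports between the same two objects, because the associators of `D` are
    -- identities.
    have hα (A B E : Brauer C) : extendMap hD F (.ofEq (tensor_assoc A B E)) ≋
        (α_ (extendObj F A) (extendObj F B) (extendObj F E)).hom := by
      rw [extendMap_ofEq, hD.associator_hom]
      refine eqToHom_congr _ _ ?_
      rw [extendObj_tensor hD, extendObj_tensor hD]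
    refine ArrowEq.eq (ArrowEq.trans ?_ ((ofEq key).trans (ArrowEq.symm ?_)))
    · exact (hα A B E).comp (((extendMap_cross hD F _ _).trans
        (braiding rfl (extendObj_tensor hD F _ _))).comp (hα B E A))
    · exact ((extendMap_tens hD F _ _).trans ((extendMap_cross hD F _ _).tensorHom self)).comp
        ((hα B A E).comp ((extendMap_tens hD F _ _).trans
          (self.tensorHom (extendMap_cross hD F _ _))))
  | up_id X =>
    exact ((extendMap_up hD F _).trans ((ofEq (F.map_id X)).trans
      (id_congr (extendObj_pos hD F X).symm))).eq
  | up_comp β γ =>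
    exact (((extendMap_up hD F _).comp (extendMap_up hD F _)).trans
      ((ofEq (F.map_comp β γ).symm).trans (extendMap_up hD F _).symm)).eq
  | down_id X =>
    exact ((extendMap_down hD F _).trans ((ofEq (by rw [F.map_id, leftAdjointMate_id])).trans
      (id_congr (extendObj_neg hD F X).symm))).eq
  | down_comp β γ =>
    exact (((extendMap_down hD F _).comp (extendMap_down hD F _)).trans
      ((ofEq (by rw [F.map_comp, comp_leftAdjointMate])).trans (extendMap_down hD F _).symm)).eq
  | cap_absorb β γ δ =>
    refine ArrowEq.eq ((((extendMap_tens hD F _ _).trans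
      ((extendMap_up hD F _).tensorHom (extendMap_down hD F _))).comp
        (extendMap_cap hD F _)).trans (ArrowEq.trans (ofEq ?_) (extendMap_cap hD F _).symm))
    rw [F.map_comp, F.map_comp]
    exact tensorHom_leftAdjointMate_comp_evaluation _ _ _
  | cup_absorb β γ δ =>
    refine ArrowEq.eq (((extendMap_cup hD F _).comp ((extendMap_tens hD F _ _).trans
      ((extendMap_down hD F _).tensorHom (extendMap_up hD F _)))).trans
        (ArrowEq.trans (ofEq ?_) (extendMap_cup hD F _).symm))
    rw [F.map_comp, F.map_comp]
    exact coevaluation_comp_tensorHom_leftAdjointMate _ _ _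
  | zigzag_pos X =>
    have h : extendMap hD F (.id (pos X)) ≋ 𝟙 (F.obj X) := id_congr (extendObj_pos hD F X)
    refine ArrowEq.eq ((extendMap_ofEq_comp hD F _ _).trans (ArrowEq.trans ?_
      ((hD.coevaluation_evaluation (ᘁ(F.obj X)) (F.obj X)).trans h.symm)))
    refine comp ((extendMap_tens hD F _ _).trans (h.tensorHom (extendMap_cup_id hD F X)))
      (comp ?_ ((extendMap_comp_ofEq hD F _ _).trans ((extendMap_tens hD F _ _).trans
        ((extendMap_cap_id hD F X).tensorHom h))))
    rw [extendMap_ofEq]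
    refine eqToHom_congr _ _ ?_
    rw [extendObj_tensor hD, extendObj_tensor hD, extendObj_pos hD, extendObj_neg hD]
  | zigzag_neg X =>
    have h : extendMap hD F (.id (neg X)) ≋ 𝟙 (ᘁ(F.obj X)) := id_congr (extendObj_neg hD F X)
    refine ArrowEq.eq ((extendMap_ofEq_comp hD F _ _).trans (ArrowEq.trans ?_
      ((hD.evaluation_coevaluation (ᘁ(F.obj X)) (F.obj X)).trans h.symm)))
    refine comp ((extendMap_tens hD F _ _).trans ((extendMap_cup_id hD F X).tensorHom h))
      (comp ?_ ((extendMap_comp_ofEq hD F _ _).trans ((extendMap_tens hD F _ _).trans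
        (h.tensorHom (extendMap_cap_id hD F X)))))
    rw [extendMap_ofEq]
    refine eqToHom_congr _ _ ?_
    rw [extendObj_tensor hD, extendObj_tensor hD, extendObj_pos hD, extendObj_neg hD]

/-- The extension of a functor to the Brauer envelope. -/
def extend : Brauer C ⥤ D where
  obj := extendObj F
  map {A B} := Quotient.lift (extendMap hD F) (fun _ _ h => extendMap_rel hD F h)
  map_id _ := rfl
  map_comp := by
    rintro A B E ⟨f⟩ ⟨g⟩
    rfl

theorem extend_isStrictSymmetricMonoidal : IsStrictSymmetricMonoidal (extend hD F) where
  obj_unit := rfl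
  obj_tensor := extendObj_tensor hD F
  map_tensor := by
    rintro A A' E E' ⟨f⟩ ⟨g⟩
    rfl
  map_braiding _ _ := rfl

theorem incl_extend : incl C ⋙ extend hD F = F :=
  CategoryTheory.Functor.ext (extendObj_pos hD F) (fun _ _ _ => rfl)

theorem extend_respectsDuals : RespectsDuals (extend_isStrictSymmetricMonoidal hD F) where
  obj_neg X := (extendObj_neg hD F X).trans (by
    -- The chosen dual in question is that of `F.obj X ⊗ 𝟙_ D`, so the object has to be rewritten
    -- inside the choice of dual.
    rw [show (extend hD F).obj (pos X) = F.obj X from extendObj_pos hD F X])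
  map_cap X := by
    refine ((extendMap_cap_id hD F X).trans (ArrowEq.trans ?_
      (eqToHom_comp_eqToHom _ _ _).symm)).eq
    rw [show (extend hD F).obj (pos X) = F.obj X from extendObj_pos hD F X]
    exact self
  map_cup X := by
    refine ((extendMap_cup_id hD F X).trans (ArrowEq.trans ?_
      (eqToHom_comp_eqToHom _ _ _).symm)).eq
    rw [show (extend hD F).obj (pos X) = F.obj X from extendObj_pos hD F X]
    exact self

end Brauer

/-! ### Isomorphisms of duals induced by isomorphisms of objects -/

section Mates

variable {D : Type u} [Category.{v} D] [MonoidalCategory D]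

/-- Evaluation is nondegenerate: tensoring with `X` is adjoint to tensoring with its dual, and both
sides of the hypothesis are transposed along this adjunction. -/
theorem eq_leftAdjointMate {X Y : D} [HasLeftDual X] [HasLeftDual Y] {f : X ⟶ Y} {g : (ᘁY) ⟶ (ᘁX)}
    (h : (𝟙 X ⊗ₘ g) ≫ ε_ (ᘁX) X = (f ⊗ₘ 𝟙 (ᘁY)) ≫ ε_ (ᘁY) Y) : g = (ᘁf) := by
  rw [id_tensorHom, tensorHom_id] at h
  have h' := congrArg (tensorLeftHomEquiv (ᘁY) (ᘁX) X (𝟙_ D)) h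
  rw [tensorLeftHomEquiv_whiskerLeft_comp_evaluation,
    tensorLeftHomEquiv_whiskerRight_comp_evaluation] at h'
  -- Both transposes end with the inverse of a right unitor, which cancels.
  exact (cancel_mono _).1 h'

variable (N P N' P' : D) [ExactPairing N P] [ExactPairing N' P']

/-- An isomorphism of objects induces an isomorphism of their left duals. -/
def leftDualMapIso (i : P ≅ P') : N ≅ N' :=
  -- The given pairings serve as local choices of duals, so that no global choice in `D` is needed.
  -- Mates are contravariant, which is why the map from `N` to `N'` is the mate of `i.inv`.
  letI : HasLeftDual P := ⟨N⟩
  letI : HasLeftDual P' := ⟨N'⟩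
  { hom := ᘁi.inv
    inv := ᘁi.hom
    hom_inv_id := by rw [← comp_leftAdjointMate, i.hom_inv_id, leftAdjointMate_id]; rfl
    inv_hom_id := by rw [← comp_leftAdjointMate, i.inv_hom_id, leftAdjointMate_id]; rfl }

theorem tensorHom_leftDualMapIso_comp_evaluation (i : P ≅ P') :
    (i.hom ⊗ₘ (leftDualMapIso N P N' P' i).hom) ≫ ε_ N' P' = ε_ N P := by
  let : HasLeftDual P := ⟨N⟩
  let : HasLeftDual P' := ⟨N'⟩
  have h := tensorHom_leftAdjointMate_comp_evaluation i.hom (𝟙 P') i.inv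
  rw [id_tensorHom_id, Category.id_comp, Category.id_comp, i.hom_inv_id, id_tensorHom_id,
    Category.id_comp] at h
  exact h

theorem coevaluation_comp_leftDualMapIso_tensorHom (i : P ≅ P') :
    η_ N P ≫ ((leftDualMapIso N P N' P' i).hom ⊗ₘ i.hom) = η_ N' P' := by
  let : HasLeftDual P := ⟨N⟩
  let : HasLeftDual P' := ⟨N'⟩
  have h := coevaluation_comp_tensorHom_leftAdjointMate i.inv (𝟙 P) i.hom
  rw [id_tensorHom_id, Category.id_comp, Category.comp_id, i.inv_hom_id, id_tensorHom_id,
    Category.comp_id] at h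
  exact h

variable {N P N' P'} in
-- Compatibility with evaluations alone determines the map on duals; this gives the uniqueness of
-- the component at `X⁻`.
theorem eq_leftDualMapIso_hom {i : P ≅ P'} {g : N ⟶ N'} (h : (i.hom ⊗ₘ g) ≫ ε_ N' P' = ε_ N P) :
    g = (leftDualMapIso N P N' P' i).hom := by
  let : HasLeftDual P := ⟨N⟩
  let : HasLeftDual P' := ⟨N'⟩
  refine eq_leftAdjointMate (X := P') (Y := P) (f := i.inv) (g := g) ?_
  change (𝟙 P' ⊗ₘ g) ≫ ε_ N' P' = (i.inv ⊗ₘ 𝟙 N) ≫ ε_ N P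
  rw [← h, tensorHom_comp_tensorHom_assoc, i.inv_hom_id, Category.id_comp]

end Mates

/-! ### Generators of the Brauer envelope -/

namespace Brauer

open ArrowEq

section

variable {C : Type u} [Category.{v} C]

/-- Lets mates of morphisms of `C` be formed in the envelope with respect to the identity caps and
cups. -/
instance hasLeftDualPos (X : C) : HasLeftDual (pos X) := ⟨neg X⟩

theorem mk_cap {X Y : C} (β : X ⟶ Y) :
    mk (.cap β) = ((incl C).map β ⊗ₘ 𝟙 (neg Y)) ≫ cap (𝟙 Y) := by
  have h := sound (Rel.cap_absorb β (𝟙 Y) (𝟙 Y))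
  rw [mk_comp, mk_tens, sound (Rel.down_id Y), Category.comp_id, Category.comp_id] at h
  exact h.symm

theorem mk_cap_eq_tensorHom_down {X Y : C} (β : X ⟶ Y) :
    mk (.cap β) = (𝟙 (pos X) ⊗ₘ mk (.down β)) ≫ cap (𝟙 X) := by
  have h := sound (Rel.cap_absorb (𝟙 X) (𝟙 X) β)
  rw [mk_comp, mk_tens, sound (Rel.up_id X), Category.id_comp, Category.id_comp] at h
  exact h.symm

theorem mk_cup {X Y : C} (β : X ⟶ Y) :
    mk (.cup β) = cup (𝟙 X) ≫ (𝟙 (neg X) ⊗ₘ (incl C).map β) := by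
  have h := sound (Rel.cup_absorb (𝟙 X) (𝟙 X) β)
  rw [mk_comp, mk_tens, sound (Rel.down_id X), Category.id_comp, Category.id_comp] at h
  exact h.symm

/-- Absorbing `β` into an identity cap along either strand gives the same labelled cap, and
nondegeneracy of evaluation then identifies `β₋`. -/
theorem mk_down {X Y : C} (β : X ⟶ Y) :
    mk (.down β) = leftAdjointMate (X := pos X) (Y := pos Y) ((incl C).map β) :=
  eq_leftAdjointMate (X := pos X) (Y := pos Y) ((mk_cap_eq_tensorHom_down β).symm.trans (mk_cap β))

/-- The morphisms of the Brauer envelope are generated by the images of morphisms of `C`, the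
crossings, and the identity caps and cups. -/
theorem hom_induction {P : ∀ ⦃A B : Brauer C⦄, (A ⟶ B) → Prop}
    (eqToHom : ∀ (A B : Brauer C) (h : A = B), P (eqToHom h))
    (comp : ∀ {A B E : Brauer C} (f : A ⟶ B) (g : B ⟶ E), P f → P g → P (f ≫ g))
    (tensorHom : ∀ {A A' B B' : Brauer C} (f : A ⟶ A') (g : B ⟶ B'), P f → P g → P (f ⊗ₘ g))
    (braiding : ∀ A B : Brauer C, P (β_ A B).hom)
    (incl_map : ∀ {X Y : C} (β : X ⟶ Y), P ((incl C).map β))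
    (cap_id : ∀ X : C, P (cap (𝟙 X)))
    (cup_id : ∀ X : C, P (cup (𝟙 X)))
    {A B : Brauer C} (f : A ⟶ B) : P f := by
  have id (A : Brauer C) : P (𝟙 A) := eqToHom A A rfl
  suffices h : ∀ {A B : Brauer C} (f : Diagram A B), P (mk f) from Quotient.inductionOn f h
  clear f
  intro A B f
  induction f with
  | id A => exact id A
  | comp f g hf hg => exact comp _ _ hf hg
  | tens f g hf hg => exact tensorHom _ _ hf hg
  | cross A B => exact braiding A B
  | up β => exact incl_map β
  | @down X Y β =>
    rw [mk_down]
    -- The mate is unfolded as cup, then `β₊` on the middle strand, then cap. The unitors and the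
    -- associator are transports, covered by the `eqToHom` case.
    exact comp _ _ (eqToHom _ _ (unit_tensor _).symm) (comp _ _ (tensorHom _ _ (cup_id _) (id _))
      (comp _ _ (tensorHom _ _ (tensorHom _ _ (id _) (incl_map β)) (id _))
        (comp _ _ (eqToHom _ _ (tensor_assoc (neg X) (pos Y) (neg Y))) (comp _ _ (tensorHom _ _ (id _) (cap_id _))
          (eqToHom _ _ (tensor_unit _))))))
  | cap β =>
    rw [mk_cap]
    exact comp _ _ (tensorHom _ _ (incl_map β) (id _)) (cap_id _)
  | cup β =>
    rw [mk_cup]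
    exact comp _ _ (cup_id _) (tensorHom _ _ (id _) (incl_map β))

end

/-! ### Uniqueness of the extension, and extension of natural isomorphisms -/

section

variable {C : Type u} [Category.{v} C] {D : Type u'} [Category.{v'} D] [MonoidalCategory D]
  [SymmetricCategory D]

/-- Agreement on one-term sequences gives agreement on objects; on morphisms it is checked on
generators, where `RespectsDuals` fixes the identity caps and cups. -/
theorem functor_eq_of_respectsDuals [LeftRigidCategory D] {G H : Brauer C ⥤ D}
    {hG : IsStrictSymmetricMonoidal G} {hH : IsStrictSymmetricMonoidal H}
    (dG : RespectsDuals hG) (dH : RespectsDuals hH) (h : incl C ⋙ G = incl C ⋙ H) : G = H := by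
  have hpos (X : C) : G.obj (pos X) = H.obj (pos X) := Functor.congr_obj h X
  have hobj (A : Brauer C) : G.obj A = H.obj A := by
    induction A using induction with
    | unit => exact hG.obj_unit.trans hH.obj_unit.symm
    | cons a A ih =>
      have ha : G.obj (gen a) = H.obj (gen a) := by
        obtain ⟨X, _ | _⟩ := a
        · exact hpos X
        · refine (dG.obj_neg X).trans (Eq.trans ?_ (dH.obj_neg X).symm)
          rw [hpos]
      exact (hG.obj_tensor (gen a) A).trans
        (Eq.trans (by rw [ha, ih]) (hH.obj_tensor (gen a) A).symm)
  have hmap {A B : Brauer C} (f : A ⟶ B) : G.map f ≋ H.map f := by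
    induction f using hom_induction with
    | eqToHom A B h =>
      rw [eqToHom_map, eqToHom_map]
      exact eqToHom_congr _ _ (hobj A)
    | comp f g hf hg =>
      rw [G.map_comp, H.map_comp]
      exact hf.comp hg
    | tensorHom f g hf hg =>
      exact (hG.map_tensorHom f g).trans ((hf.tensorHom hg).trans (hH.map_tensorHom f g).symm)
    | braiding A B =>
      exact (hG.map_braiding_arrowEq A B).trans ((ArrowEq.braiding (hobj A) (hobj B)).trans
        (hH.map_braiding_arrowEq A B).symm)
    | incl_map β => exact of_functor_eq h β
    | cap_id X =>
      rw [dG.map_cap, dH.map_cap]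
      refine (eqToHom_comp_eqToHom _ _ _).trans (ArrowEq.trans ?_
        (eqToHom_comp_eqToHom _ _ _).symm)
      rw [hpos]
      exact self
    | cup_id X =>
      rw [dG.map_cup, dH.map_cup]
      refine (eqToHom_comp_eqToHom _ _ _).trans (ArrowEq.trans ?_
        (eqToHom_comp_eqToHom _ _ _).symm)
      rw [hpos]
      exact self
  exact CategoryTheory.Functor.ext hobj (fun A B f => (hmap f).eq_conj (hobj A) (hobj B).symm)

variable {G H : Brauer C ⥤ D}

/-- The exact pairing of the images of `X⁻` and `X⁺`. -/
@[reducible]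
def mapExactPairingNegPos (hD : IsStrictMonoidal D) (hG : IsStrictSymmetricMonoidal G) (X : C) :
    ExactPairing (G.obj (neg X)) (G.obj (pos X)) :=
  hG.mapExactPairing (isStrictMonoidal C) hD (neg X) (pos X)

theorem evaluation_mapExactPairingNegPos (hD : IsStrictMonoidal D)
    (hG : IsStrictSymmetricMonoidal G) (X : C) :
    (mapExactPairingNegPos hD hG X).evaluation' ≋ G.map (cap (𝟙 X)) :=
  eqToHom_comp_eqToHom _ _ _

theorem coevaluation_mapExactPairingNegPos (hD : IsStrictMonoidal D)
    (hG : IsStrictSymmetricMonoidal G) (X : C) :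
    (mapExactPairingNegPos hD hG X).coevaluation' ≋ G.map (cup (𝟙 X)) :=
  eqToHom_comp_eqToHom _ _ _

variable (hD : IsStrictMonoidal D) (hG : IsStrictSymmetricMonoidal G)
  (hH : IsStrictSymmetricMonoidal H) (φ : incl C ⋙ G ≅ incl C ⋙ H)

/-- The component at a one-term sequence of the extension of `φ`. -/
def extendIsoGen : ∀ a : C × BrauerSign, G.obj (gen a) ≅ H.obj (gen a)
  | (X, .plus) => φ.app X
  | (X, .minus) =>
    letI := mapExactPairingNegPos hD hG X
    letI := mapExactPairingNegPos hD hH X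
    leftDualMapIso (G.obj (neg X)) (G.obj (pos X)) (H.obj (neg X)) (H.obj (pos X)) (φ.app X)

/-- The component at a sequence of the extension of `φ`. -/
def extendIsoApp : ∀ A : List (C × BrauerSign), G.obj (A : Brauer C) ≅ H.obj (A : Brauer C)
  | [] => eqToIso (hG.obj_unit.trans hH.obj_unit.symm)
  | a :: A => eqToIso (hG.obj_tensor (gen a) A) ≪≫
      (extendIsoGen hD hG hH φ a ⊗ᵢ extendIsoApp A) ≪≫ eqToIso (hH.obj_tensor (gen a) A).symm

theorem extendIsoApp_unit_arrowEq : (extendIsoApp hD hG hH φ (unit C)).hom ≋ 𝟙 (𝟙_ D) :=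
  (eqToHom_id (hG.obj_unit.trans hH.obj_unit.symm)).trans (id_congr hG.obj_unit)

theorem extendIsoApp_cons (a : C × BrauerSign) (A : Brauer C) :
    (extendIsoApp hD hG hH φ ((gen a).tensor A)).hom ≋
      (extendIsoGen hD hG hH φ a).hom ⊗ₘ (extendIsoApp hD hG hH φ A).hom :=
  eqToHom_comp_eqToHom (hG.obj_tensor (gen a) A) _ (hH.obj_tensor (gen a) A).symm

theorem extendIsoApp_gen (a : C × BrauerSign) :
    extendIsoApp hD hG hH φ (gen a) = extendIsoGen hD hG hH φ a :=
  Iso.ext ((extendIsoApp_cons hD hG hH φ a (unit C)).trans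
    ((self.tensorHom (extendIsoApp_unit_arrowEq hD hG hH φ)).trans (hD.tensorHom_unit _))).eq

theorem extendIsoApp_tensor (A B : Brauer C) :
    (extendIsoApp hD hG hH φ (A.tensor B)).hom ≋
      (extendIsoApp hD hG hH φ A).hom ⊗ₘ (extendIsoApp hD hG hH φ B).hom := by
  induction A using induction with
  | unit =>
    exact ((hD.unit_tensorHom _).symm.trans
      ((extendIsoApp_unit_arrowEq hD hG hH φ).symm.tensorHom self))
  | cons a A ih =>
    exact (extendIsoApp_cons hD hG hH φ a (A.tensor B)).trans ((self.tensorHom ih).trans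
      ((hD.tensorHom_assoc _ _ _).symm.trans
        ((extendIsoApp_cons hD hG hH φ a A).symm.tensorHom self)))

/-- The content of naturality at an identity cap: the component at `X⁻` was chosen to preserve
evaluations. -/
theorem extendIsoApp_cap (X : C) :
    ((extendIsoApp hD hG hH φ (pos X)).hom ⊗ₘ (extendIsoApp hD hG hH φ (neg X)).hom) ≫
      (mapExactPairingNegPos hD hH X).evaluation' =
        (mapExactPairingNegPos hD hG X).evaluation' := by
  let := mapExactPairingNegPos hD hG X
  let := mapExactPairingNegPos hD hH X
  rw [show extendIsoApp hD hG hH φ (pos X) = φ.app X from extendIsoApp_gen hD hG hH φ (X, .plus),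
    show extendIsoApp hD hG hH φ (neg X) = _ from extendIsoApp_gen hD hG hH φ (X, .minus)]
  exact tensorHom_leftDualMapIso_comp_evaluation (G.obj (neg X)) (G.obj (pos X))
    (H.obj (neg X)) (H.obj (pos X)) (φ.app X)

theorem extendIsoApp_cup (X : C) :
    (mapExactPairingNegPos hD hG X).coevaluation' ≫
      ((extendIsoApp hD hG hH φ (neg X)).hom ⊗ₘ (extendIsoApp hD hG hH φ (pos X)).hom) =
        (mapExactPairingNegPos hD hH X).coevaluation' := by
  let := mapExactPairingNegPos hD hG X
  let := mapExactPairingNegPos hD hH X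
  rw [show extendIsoApp hD hG hH φ (pos X) = φ.app X from extendIsoApp_gen hD hG hH φ (X, .plus),
    show extendIsoApp hD hG hH φ (neg X) = _ from extendIsoApp_gen hD hG hH φ (X, .minus)]
  exact coevaluation_comp_leftDualMapIso_tensorHom (G.obj (neg X)) (G.obj (pos X))
    (H.obj (neg X)) (H.obj (pos X)) (φ.app X)

/-- Naturality squares can be composed and tensored, so generators suffice. Crossings use naturality
of the braiding, and morphisms of `C` use naturality of `φ`. -/
theorem extendIsoApp_naturality {A B : Brauer C} (f : A ⟶ B) :
    G.map f ≫ (extendIsoApp hD hG hH φ B).hom = (extendIsoApp hD hG hH φ A).hom ≫ H.map f := by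
  induction f using hom_induction with
  | eqToHom A B h =>
    subst h
    simp
  | comp f g hf hg => rw [G.map_comp, H.map_comp, Category.assoc, hg, reassoc_of% hf]
  | tensorHom f g hf hg =>
    refine (((hG.map_tensorHom f g).comp (extendIsoApp_tensor hD hG hH φ _ _)).trans
      (ArrowEq.trans (ofEq ?_) ((extendIsoApp_tensor hD hG hH φ _ _).comp
        (hH.map_tensorHom f g)).symm)).eq
    rw [tensorHom_comp_tensorHom, tensorHom_comp_tensorHom, hf, hg]
  | braiding A B =>
    exact (((hG.map_braiding_arrowEq A B).comp (extendIsoApp_tensor hD hG hH φ _ _)).trans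
      ((ofEq (BraidedCategory.braiding_naturality _ _).symm).trans
        ((extendIsoApp_tensor hD hG hH φ _ _).comp (hH.map_braiding_arrowEq A B)).symm)).eq
  | @incl_map X Y β =>
    have h := φ.hom.naturality β
    have hX (X : C) : extendIsoApp hD hG hH φ ((incl C).obj X) = φ.app X :=
      extendIsoApp_gen hD hG hH φ (X, .plus)
    rw [hX, hX]
    exact h
  | cap_id X =>
    -- The component at the target of the cap, the unit, is a transport and drops out.
    refine ((comp_eqToHom _ (hG.obj_unit.trans hH.obj_unit.symm)).trans
      ((evaluation_mapExactPairingNegPos hD hG X).symm.trans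
      ((ofEq (extendIsoApp_cap hD hG hH φ X).symm).trans (ArrowEq.symm ?_)))).eq
    exact (extendIsoApp_tensor hD hG hH φ (pos X) (neg X)).comp
      (evaluation_mapExactPairingNegPos hD hH X).symm
  | cup_id X =>
    refine (ArrowEq.trans ?_ ((ofEq (extendIsoApp_cup hD hG hH φ X)).trans
      ((coevaluation_mapExactPairingNegPos hD hH X).trans
        (eqToHom_comp (hG.obj_unit.trans hH.obj_unit.symm) _).symm))).eq
    exact (coevaluation_mapExactPairingNegPos hD hG X).symm.comp
      (extendIsoApp_tensor hD hG hH φ (neg X) (pos X))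

/-- The extension of an isomorphism of restrictions to an isomorphism of functors. -/
def extendIso : G ≅ H :=
  NatIso.ofComponents (fun A => extendIsoApp hD hG hH φ A)
    (fun f => extendIsoApp_naturality hD hG hH φ f)

theorem extendIso_isMonoidalIso : IsMonoidalIso hG hH (extendIso hD hG hH φ) where
  app_unit := rfl
  app_tensor A B := (extendIsoApp_tensor hD hG hH φ A B).eq_conj _ _

theorem isoWhiskerLeft_extendIso :
    Functor.isoWhiskerLeft (incl C) (extendIso hD hG hH φ) = φ := by
  ext X
  exact congrArg Iso.hom (extendIsoApp_gen hD hG hH φ (X, .plus))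

variable {hG hH} in
-- A monoidal isomorphism is determined by its components at one-term sequences; those at `X⁺` are
-- given by `φ`, and those at `X⁻` are forced by naturality at the identity cap.
theorem eq_extendIso {θ : G ≅ H} (hθ : IsMonoidalIso hG hH θ)
    (h : Functor.isoWhiskerLeft (incl C) θ = φ) : θ = extendIso hD hG hH φ := by
  have htensor (A B : Brauer C) : θ.hom.app (A.tensor B) ≋ θ.hom.app A ⊗ₘ θ.hom.app B :=
    (ofEq (hθ.app_tensor A B)).trans (eqToHom_comp_eqToHom _ _ _)
  have hpos (X : C) : θ.hom.app (pos X) = (φ.app X).hom := by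
    subst h
    rfl
  have hneg (X : C) : θ.hom.app (neg X) = (extendIsoGen hD hG hH φ (X, .minus)).hom := by
    let := mapExactPairingNegPos hD hG X
    let := mapExactPairingNegPos hD hH X
    refine eq_leftDualMapIso_hom (N := G.obj (neg X)) (P := G.obj (pos X)) (N' := H.obj (neg X))
      (P' := H.obj (pos X)) ?_
    -- As the component at the unit is a transport, this square says that `θ` at `X⁺ ⊗ X⁻` carries
    -- one evaluation to the other.
    have hn := θ.hom.naturality (cap (𝟙 X))
    rw [hθ.app_unit] at hn
    refine ArrowEq.eq (ArrowEq.trans (ArrowEq.comp ?_ (evaluation_mapExactPairingNegPos hD hH X))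
      ((ofEq hn.symm).trans
        ((comp_eqToHom _ _).trans (evaluation_mapExactPairingNegPos hD hG X).symm)))
    rw [← hpos]
    exact (htensor (pos X) (neg X)).symm
  ext A
  change θ.hom.app A = (extendIsoApp hD hG hH φ A).hom
  induction A using induction with
  | unit => exact hθ.app_unit
  | cons a A ih =>
    have ha : θ.hom.app (gen a) = (extendIsoGen hD hG hH φ a).hom := by
      obtain ⟨X, _ | _⟩ := a
      · exact hpos X
      · exact hneg X
    exact ((htensor (gen a) A).trans (((ofEq ha).tensorHom (ofEq ih)).trans
      (extendIsoApp_cons hD hG hH φ a A).symm)).eq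

end

end Brauer

/-! ### The proposition -/

theorem mainTheorem9 (C : Type u) [Category.{v} C] :
    -- the Brauer envelope is strict monoidal, for its symmetric monoidal structure
    IsStrictMonoidal (Brauer C) ∧
    -- and rigid, with the expected duals, cups and caps
    (∃ _ : RigidCategory (Brauer C),
      ∀ A : Brauer C, (ᘁA : Brauer C) = A.dual ∧ (Aᘁ : Brauer C) = A.dual) ∧
    (∀ X : C, ∃ p : ExactPairing (Brauer.neg X) (Brauer.pos X),
      p.evaluation' = Brauer.cap (𝟙 X) ∧ p.coevaluation' = Brauer.cup (𝟙 X)) ∧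
    -- it contains `C` as a subcategory
    Function.Injective (Brauer.incl C).obj ∧ (Brauer.incl C).Faithful ∧
    -- unique extension to strict rigid symmetric monoidal categories
    (∀ (D : Type u') [Category.{v'} D] [MonoidalCategory D] [SymmetricCategory D]
      [LeftRigidCategory D], IsStrictMonoidal D → ∀ F : C ⥤ D,
      ∃! G : Brauer C ⥤ D, Brauer.incl C ⋙ G = F ∧
        ∃ hG : IsStrictSymmetricMonoidal G, RespectsDuals hG) ∧
    -- for any choice of duals, the extension is unique up to a unique monoidal isomorphism
    (∀ (D : Type u') [Category.{v'} D] [MonoidalCategory D] [SymmetricCategory D],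
      IsStrictMonoidal D → ∀ (G H : Brauer C ⥤ D) (hG : IsStrictSymmetricMonoidal G)
      (hH : IsStrictSymmetricMonoidal H) (φ : Brauer.incl C ⋙ G ≅ Brauer.incl C ⋙ H),
      ∃! θ : G ≅ H, IsMonoidalIso hG hH θ ∧
        Functor.isoWhiskerLeft (Brauer.incl C) θ = φ) := by
  refine ⟨Brauer.isStrictMonoidal C, ⟨Brauer.rigid, fun _ => ⟨rfl, rfl⟩⟩,
    fun X => ⟨Brauer.exactPairingNegPos X, rfl, rfl⟩, Brauer.incl_obj_injective,
    Brauer.incl_faithful, ?_, ?_⟩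
  · intro D _ _ _ _ hD F
    refine ⟨Brauer.extend hD F, ⟨Brauer.incl_extend hD F,
      Brauer.extend_isStrictSymmetricMonoidal hD F, Brauer.extend_respectsDuals hD F⟩, ?_⟩
    rintro G ⟨hF, hG, dG⟩
    exact Brauer.functor_eq_of_respectsDuals dG (Brauer.extend_respectsDuals hD F)
      (hF.trans (Brauer.incl_extend hD F).symm)
  · intro D _ _ _ hD G H hG hH φ
    refine ⟨Brauer.extendIso hD hG hH φ, ⟨Brauer.extendIso_isMonoidalIso hD hG hH φ,
      Brauer.isoWhiskerLeft_extendIso hD hG hH φ⟩, ?_⟩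
    rintro θ ⟨hθ, h⟩
    exact Brauer.eq_extendIso hD φ hθ h
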